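/- Throughout, signed permutations of $\{1,\dots,n\}$ act on $\mathbb C^n$ by permuting the standard basis vectors up to sign, $s_{ij}$ is the transposition of $i,j$, $\overline s_{ij}$ is this transposition coupled with sign changes at $i$ and $j$, and $\tau_i$ is the sign change at $i$. Let $n$ be a natural number and let $W$ be $W_{A_{n-1}}=S_n$, $W_{D_n}$ (signed permutations with an even number of sign changes) or $W_{B_n}$ (all signed permutations); let $u\in\mathbb C$ and, in type $B$, also $v\in\mathbb C$. The rational double affine Hecke–Clifford algebra $\mathfrak H_W$ is the unital associative $\mathbb C$-algebra generated by $x_i,y_i,c_i$ $(1\le i\le n)$ and the group $W$ subject to $$c_i^2=1,\quad c_ic_j=-c_jc_i\ (i\ne j),\quad x_ix_j=x_jx_i,\quad y_iy_j=y_jy_i,\quad y_ic_j=c_jy_i,$$ $$x_ic_i=-c_ix_i,\quad x_ic_j=c_jx_i\ (i\neq j),\quad w\xi w^{-1}=w(\xi)\ \text{ for } w\in W \text{ and } \xi\in\{x_i,y_i,c_i\},$$ where $W$ permutes, up to sign, each of the families $(x_i)$, $(y_i)$, $(c_i)$ as it does the standard basis of $\mathbb C^n$, together with the following relations. * Type $A$: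 $[y_j,x_i]=u(1+c_jc_i)s_{ji}$ for $i\ne j$, and $[y_i,x_i]=-u\sum_{k\ne i}(1+c_kc_i)s_{ki}$. * Types $D$ and $B$: $[y_j,x_i]=u\big((1+c_jc_i)s_{ij}-(1-c_jc_i)\overline s_{ij}\big)$ for $i\neq j$, and $[y_i,x_i]=-u\sum_{k\neq i}\big((1+c_kc_i)s_{ki}+(1-c_kc_i)\overline s_{ki}\big)-\delta\sqrt2\,v\,\tau_i$, where $\delta=0$ in type $D$ and $\delta=1$ in type $B$. It is a superalgebra ($\mathbb Z/2$-graded algebra) with each $c_i$ odd and all $x_i$, $y_i$ and $w\in W$ even. Its even center $\mathcal Z(\mathfrak H_W)$ is the subalgebra of even central elements. **Proposition.** The even center $\mathcal Z(\mathfrak H_W)$ contains $\mathbb C[y_1,\dots,y_n]^W$ and $\mathbb C[x_1^2,\dots,x_n^2]^W$ as subalgebras; that is, the natural homomorphisms from these algebras of $W$-invariant polynomials to $\mathfrak H_W$ are injective with image in $\mathcal Z(\mathfrak H_W)$. In particular, $\mathfrak H_W$ is a finitely generated module over its even center. -/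

import Mathlib

open MvPolynomial

noncomputable section

namespace Dahca

/-- Signed permutations of `n` letters, the semidirect product of sign vectors by permutations.
The pair `⟨ε, π⟩` acts on `ℂⁿ` by `e i ↦ ε (π i) e (π i)`; see `coeff` and `coeff_mul`. -/
abbrev SignedPerm (n : ℕ) : Type :=
  (Fin n → ℤˣ) ⋊[mulAutArrow] Equiv.Perm (Fin n)

/-- The sign with which `g` maps the basis vector `e i` to `± e (g.right i)`. -/
def coeff {n : ℕ} (g : SignedPerm n) (i : Fin n) : ℂ :=
  (((g.left (g.right i) : ℤˣ) : ℤ) : ℂ)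

theorem left_mul_apply {n : ℕ} (g h : SignedPerm n) (i : Fin n) :
    (g * h).left i = g.left i * h.left (g.right⁻¹ i) := rfl

/-- The assignment `e i ↦ coeff g i • e (g.right i)` is a group action. -/
theorem coeff_mul {n : ℕ} (g h : SignedPerm n) (i : Fin n) :
    coeff (g * h) i = coeff g (h.right i) * coeff h i := by
  simp [coeff, left_mul_apply]

/-- The Weyl group of type `A_{n-1}`: permutations without sign changes. -/
def weylA (n : ℕ) : Subgroup (SignedPerm n) where
  carrier := {g | ∀ i, g.left i = 1}
  one_mem' := fun _ => rfl
  mul_mem' := by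
    intro g h hg hh i
    rw [left_mul_apply, hg, hh, one_mul]
  inv_mem' := by
    intro g hg i
    have h1 := left_mul_apply g g⁻¹ (g.right i)
    rw [mul_inv_cancel, hg, one_mul] at h1
    simpa using h1.symm

/-- The Weyl group of type `D_n`: signed permutations with an even number of sign changes. -/
def weylD (n : ℕ) : Subgroup (SignedPerm n) where
  carrier := {g | ∏ i, g.left i = 1}
  one_mem' := by simp
  mul_mem' := by
    intro g h hg hh
    simp only [Set.mem_ofPred_eq] at hg hh ⊢
    simp only [left_mul_apply, Finset.prod_mul_distrib, hg, one_mul]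
    rw [← hh]
    exact Equiv.prod_comp g.right⁻¹ h.left
  inv_mem' := by
    intro g hg
    simp only [Set.mem_ofPred_eq] at hg ⊢
    have h1 : ∏ i, (g * g⁻¹).left i = 1 := by simp
    simp only [left_mul_apply, Finset.prod_mul_distrib, hg, one_mul] at h1
    rw [← h1]
    exact (Equiv.prod_comp g.right⁻¹ (g⁻¹).left).symm

/-- The Weyl group of type `B_n`: all signed permutations. -/
def weylB (n : ℕ) : Subgroup (SignedPerm n) := ⊤

/-- The transposition `s_{ij}`. -/
def swp {n : ℕ} (i j : Fin n) : SignedPerm n := ⟨1, Equiv.swap i j⟩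

/-- The transposition of `i` and `j` (`i ≠ j`) coupled with the sign changes at `i` and `j`. -/
def swpBar {n : ℕ} (i j : Fin n) : SignedPerm n :=
  ⟨Pi.mulSingle i (-1) * Pi.mulSingle j (-1), Equiv.swap i j⟩

/-- The sign change `τ_i` at `i`. -/
def tau {n : ℕ} (i : Fin n) : SignedPerm n := ⟨Pi.mulSingle i (-1), 1⟩

theorem swp_mem_weylA {n : ℕ} (i j : Fin n) : swp i j ∈ weylA n := fun _ => rfl

theorem swp_mem_weylD {n : ℕ} (i j : Fin n) : swp i j ∈ weylD n := by
  simp [swp, weylD]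

theorem swpBar_mem_weylD {n : ℕ} (i j : Fin n) : swpBar i j ∈ weylD n := by
  simp [swpBar, weylD, Finset.prod_mul_distrib]

/-- The type of the algebra, together with its parameters. -/
inductive Datum : Type
  | A (u : ℂ)
  | D (u : ℂ)
  | B (u v : ℂ)

/-- The Weyl group attached to the type, in rank parameter `n`. -/
def Datum.W (n : ℕ) : Datum → Subgroup (SignedPerm n)
  | .A _ => weylA n
  | .D _ => weylD n
  | .B _ _ => weylB n

/-- Generators `x_i`, `y_i`, `c_i` (`1 ≤ i ≤ n`) and the elements of `W`. -/
inductive Gen {n : ℕ} (W : Subgroup (SignedPerm n)) : Type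
  | x (i : Fin n)
  | y (i : Fin n)
  | c (i : Fin n)
  | w (g : W)

section Free

variable {n : ℕ} {W : Subgroup (SignedPerm n)}

/-- The generators as elements of the free algebra. -/
abbrev fx (i : Fin n) : FreeAlgebra ℂ (Gen W) := FreeAlgebra.ι ℂ (Gen.x i)
/-- See `fx`. -/
abbrev fy (i : Fin n) : FreeAlgebra ℂ (Gen W) := FreeAlgebra.ι ℂ (Gen.y i)
/-- See `fx`. -/
abbrev fc (i : Fin n) : FreeAlgebra ℂ (Gen W) := FreeAlgebra.ι ℂ (Gen.c i)
/-- See `fx`. -/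
abbrev fw (g : W) : FreeAlgebra ℂ (Gen W) := FreeAlgebra.ι ℂ (Gen.w g)

end Free

/-- The value of the commutator `[y_j, x_i]` in type `A_{n-1}`. -/
def bracketA (n : ℕ) (u : ℂ) (j i : Fin n) : FreeAlgebra ℂ (Gen (weylA n)) :=
  let s : Fin n → Fin n → FreeAlgebra ℂ (Gen (weylA n)) :=
    fun k l => fw ⟨swp k l, swp_mem_weylA k l⟩
  if j = i then -(u • ∑ k ∈ Finset.univ.erase i, (1 + fc k * fc i) * s k i)
  else u • ((1 + fc j * fc i) * s j i)

/-- The value of the commutator `[y_j, x_i]` in type `D_n`. -/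
def bracketD (n : ℕ) (u : ℂ) (j i : Fin n) : FreeAlgebra ℂ (Gen (weylD n)) :=
  let s : Fin n → Fin n → FreeAlgebra ℂ (Gen (weylD n)) :=
    fun k l => fw ⟨swp k l, swp_mem_weylD k l⟩
  let sb : Fin n → Fin n → FreeAlgebra ℂ (Gen (weylD n)) :=
    fun k l => fw ⟨swpBar k l, swpBar_mem_weylD k l⟩
  if j = i then
    -(u • ∑ k ∈ Finset.univ.erase i,
        ((1 + fc k * fc i) * s k i + (1 - fc k * fc i) * sb k i))
  else u • ((1 + fc j * fc i) * s i j - (1 - fc j * fc i) * sb i j)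

/-- The value of the commutator `[y_j, x_i]` in type `B_n`. -/
def bracketB (n : ℕ) (u v : ℂ) (j i : Fin n) : FreeAlgebra ℂ (Gen (weylB n)) :=
  let s : Fin n → Fin n → FreeAlgebra ℂ (Gen (weylB n)) :=
    fun k l => fw ⟨swp k l, Subgroup.mem_top _⟩
  let sb : Fin n → Fin n → FreeAlgebra ℂ (Gen (weylB n)) :=
    fun k l => fw ⟨swpBar k l, Subgroup.mem_top _⟩
  let t : Fin n → FreeAlgebra ℂ (Gen (weylB n)) :=
    fun k => fw ⟨tau k, Subgroup.mem_top _⟩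
  if j = i then
    -(u • ∑ k ∈ Finset.univ.erase i,
        ((1 + fc k * fc i) * s k i + (1 - fc k * fc i) * sb k i))
      - (((Real.sqrt 2 : ℝ) : ℂ) * v) • t i
  else u • ((1 + fc j * fc i) * s i j - (1 - fc j * fc i) * sb i j)

/-- The prescribed value of the commutator `[y_j, x_i]`. -/
def bracket (n : ℕ) : (T : Datum) → (j i : Fin n) → FreeAlgebra ℂ (Gen (T.W n))
  | .A u => bracketA n u
  | .D u => bracketD n u
  | .B u v => bracketB n u v

/-- The defining relations. The relations `w ξ w⁻¹ = w(ξ)` are imposed on the generators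
`ξ = x_i, y_i, c_i`. -/
inductive Rel (n : ℕ) (T : Datum) :
    FreeAlgebra ℂ (Gen (T.W n)) → FreeAlgebra ℂ (Gen (T.W n)) → Prop
  | w_one : Rel n T (fw 1) 1
  | w_mul (g h : T.W n) : Rel n T (fw g * fw h) (fw (g * h))
  | c_sq (i : Fin n) : Rel n T (fc i * fc i) 1
  | c_anti (i j : Fin n) (hij : i ≠ j) : Rel n T (fc i * fc j) (-(fc j * fc i))
  | x_comm (i j : Fin n) : Rel n T (fx i * fx j) (fx j * fx i)
  | y_comm (i j : Fin n) : Rel n T (fy i * fy j) (fy j * fy i)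
  | y_c (i j : Fin n) : Rel n T (fy i * fc j) (fc j * fy i)
  | x_c_same (i : Fin n) : Rel n T (fx i * fc i) (-(fc i * fx i))
  | x_c (i j : Fin n) (hij : i ≠ j) : Rel n T (fx i * fc j) (fc j * fx i)
  | w_x (g : T.W n) (i : Fin n) :
      Rel n T (fw g * fx i * fw g⁻¹) (coeff g.1 i • fx (g.1.right i))
  | w_y (g : T.W n) (i : Fin n) :
      Rel n T (fw g * fy i * fw g⁻¹) (coeff g.1 i • fy (g.1.right i))
  | w_c (g : T.W n) (i : Fin n) :
      Rel n T (fw g * fc i * fw g⁻¹) (coeff g.1 i • fc (g.1.right i))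
  | y_x (j i : Fin n) : Rel n T (fy j * fx i - fx i * fy j) (bracket n T j i)

/-- The rational double affine Hecke-Clifford algebra of the given type and parameters. -/
abbrev H (n : ℕ) (T : Datum) : Type := RingQuot (Rel n T)

/-- A generator as an element of the algebra. -/
def gen (n : ℕ) (T : Datum) (a : Gen (T.W n)) : H n T :=
  RingQuot.mkAlgHom ℂ (Rel n T) (FreeAlgebra.ι ℂ a)

/-- The `ℤ/2`-degree of a generator: `c_i` is odd, all others are even. -/
def degree {n : ℕ} {W : Subgroup (SignedPerm n)} : Gen W → ZMod 2
  | .c _ => 1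
  | _ => 0

/-- The homogeneous component of degree `d` of the superalgebra: the span of the products of
generators of total degree `d`. -/
def component (n : ℕ) (T : Datum) (d : ZMod 2) : Submodule ℂ (H n T) :=
  Submodule.span ℂ {a | ∃ l : List (Gen (T.W n)),
    (l.map degree).sum = d ∧ a = (l.map (gen n T)).prod}

theorem one_mem_component (n : ℕ) (T : Datum) : (1 : H n T) ∈ component n T 0 :=
  Submodule.subset_span ⟨[], rfl, rfl⟩

theorem mul_mem_component (n : ℕ) (T : Datum) {d e : ZMod 2} {a b : H n T}
    (ha : a ∈ component n T d) (hb : b ∈ component n T e) :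
    a * b ∈ component n T (d + e) := by
  have h := Submodule.mul_mem_mul ha hb
  rw [component, component, Submodule.span_mul_span] at h
  refine Submodule.span_mono ?_ h
  rintro _ ⟨_, ⟨l, hl, rfl⟩, _, ⟨m, hm, rfl⟩, rfl⟩
  exact ⟨l ++ m, by simp [hl, hm], by simp⟩

/-- The even part of the superalgebra. -/
def evenPart (n : ℕ) (T : Datum) : Subalgebra ℂ (H n T) where
  carrier := component n T 0
  mul_mem' := by
    intro a b ha hb
    simpa using mul_mem_component n T ha hb
  add_mem' := fun ha hb => (component n T 0).add_mem ha hb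
  algebraMap_mem' := by
    intro r
    rw [Algebra.algebraMap_eq_smul_one]
    exact (component n T 0).smul_mem r (one_mem_component n T)

/-- The even center: the even central elements. -/
def evenCenter (n : ℕ) (T : Datum) : Subalgebra ℂ (H n T) :=
  evenPart n T ⊓ Subalgebra.center ℂ (H n T)

/-- The action of a signed permutation on polynomials, induced from the action on the span of the
variables. -/
def polyAct {n : ℕ} (g : SignedPerm n) :
    MvPolynomial (Fin n) ℂ →ₐ[ℂ] MvPolynomial (Fin n) ℂ :=
  aeval fun i => coeff g i • X (g.right i)

/-- The algebra of `W`-invariant polynomials. -/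
def invariants {n : ℕ} (W : Subgroup (SignedPerm n)) : Subalgebra ℂ (MvPolynomial (Fin n) ℂ) :=
  ⨅ g : W, AlgHom.equalizer (polyAct g.1) (AlgHom.id ℂ _)

theorem mem_invariants {n : ℕ} (W : Subgroup (SignedPerm n)) (f : MvPolynomial (Fin n) ℂ) :
    f ∈ invariants W ↔ ∀ g ∈ W, polyAct g f = f := by
  simp [invariants, Algebra.mem_iInf, AlgHom.mem_equalizer]

/-- The algebra of polynomials in the squares of the variables. -/
def squarePolys (n : ℕ) : Subalgebra ℂ (MvPolynomial (Fin n) ℂ) :=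
  Algebra.adjoin ℂ (Set.range fun i : Fin n => (X i : MvPolynomial (Fin n) ℂ) ^ 2)

section Eval

variable {A : Type} [Ring A] [Algebra ℂ A] {n : ℕ}

/-- Evaluation of polynomials at pairwise commuting elements of an algebra. -/
def polyEval (a : Fin n → A) (ha : ∀ i j, a i * a j = a j * a i) :
    MvPolynomial (Fin n) ℂ →ₐ[ℂ] A :=
  have hc : IsMulCommutative (Algebra.adjoin ℂ (Set.range a)) :=
    Algebra.isMulCommutative_adjoin ℂ (by rintro _ ⟨i, rfl⟩ _ ⟨j, rfl⟩; exact ha i j)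
  letI : CommRing (Algebra.adjoin ℂ (Set.range a)) :=
    { (inferInstance : Ring (Algebra.adjoin ℂ (Set.range a))) with
      mul_comm := hc.is_comm.comm }
  (Algebra.adjoin ℂ (Set.range a)).val.comp
    (aeval fun i => (⟨a i, Algebra.subset_adjoin ⟨i, rfl⟩⟩ : Algebra.adjoin ℂ (Set.range a)))

theorem polyEval_X (a : Fin n → A) (ha : ∀ i j, a i * a j = a j * a i) (i : Fin n) :
    polyEval a ha (X i) = a i := by
  simp [polyEval]

end Eval

theorem x_mul_comm (n : ℕ) (T : Datum) (i j : Fin n) :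
    gen n T (.x i) * gen n T (.x j) = gen n T (.x j) * gen n T (.x i) := by
  simp only [gen, ← map_mul]
  exact RingQuot.mkAlgHom_rel ℂ (Rel.x_comm i j)

theorem y_mul_comm (n : ℕ) (T : Datum) (i j : Fin n) :
    gen n T (.y i) * gen n T (.y j) = gen n T (.y j) * gen n T (.y i) := by
  simp only [gen, ← map_mul]
  exact RingQuot.mkAlgHom_rel ℂ (Rel.y_comm i j)

/-- The homomorphism from polynomials to the algebra sending the variables to the `x_i`. -/
def polyX (n : ℕ) (T : Datum) : MvPolynomial (Fin n) ℂ →ₐ[ℂ] H n T :=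
  polyEval (fun i => gen n T (.x i)) (x_mul_comm n T)

/-- The homomorphism from polynomials to the algebra sending the variables to the `y_i`. -/
def polyY (n : ℕ) (T : Datum) : MvPolynomial (Fin n) ℂ →ₐ[ℂ] H n T :=
  polyEval (fun i => gen n T (.y i)) (y_mul_comm n T)

end Dahca

end

noncomputable section

namespace Dahca

/-! ### Signed permutations -/

section SignedPerm

variable {n : ℕ}

/-! The three types are treated at once. Extending `w ↦ w` by zero to all signed permutations turns
every prescribed commutator into the single expression `cross u v c s j i`: in type A the terms with
`swpBar` vanish, and in types A and D the coefficient of `tau` is zero (`map_bracket`).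

Injectivity comes from a representation. If the `x_i`, the `c_i` and `W` act on `M`, then all
generators act on `ℂ[y] ⊗ M`: `y_i` by multiplication, and `x_i` by a Dunkl operator `opX` made of
divided differences. An operator that intertwines the `y_j` with some operators and kills `1 ⊗ M` is
zero (`eq_zero_of_vacuum`). The relations involving the Dunkl operators therefore reduce to
relations in `M` and to three compatibilities of `cross`: with the `c_l` (`cross_mul_c`), with `W`
(`s_mul_cross`), and the Jacobi identity for `[x_i, x_j] = 0` (`cross_comm`). With `M = ℂ[x] ⊗ Cl`,
a polynomial `f` in the `y_i` sends `1 ⊗ 1 ⊗ 1` to `f ⊗ 1 ⊗ 1`, and one in the `x_i` sends it to `1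
⊗ f ⊗ 1`.

Centrality rests on the fact that a derivation of a polynomial ring is known from its values on the
variables. On `ℂ[y]` the commutator with `x_i` is a combination of divided differences along
reflections, with coefficients that vanish when the reflection is not in `W` (`commDer_polyY`), so
it kills the invariants. On `ℂ[x²]` the commutator with `y_j` involves only divided differences
along transpositions (`commDer_polyXSq`). The decisive identity there is `anti_self`, which amounts
to `y_j` commuting with `∑ x_k²`.

For finiteness, products of a polynomial in `y`, a polynomial in `x`, a Clifford element and a group
element span the algebra (`orderedSpan_eq_top`). Polynomials are finite over the symmetric
polynomials in the squares, because each variable is a root of `∏ (t² - X_j²)`. These symmetric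
polynomials become central both in `x` and in `y`, whatever the type. -/

theorem coeff_sq (g : SignedPerm n) (i : Fin n) : coeff g i * coeff g i = 1 := by
  rcases Int.units_eq_one_or (g.left (g.right i)) with h | h <;> simp [coeff, h]

theorem coeff_eq_or (g : SignedPerm n) (i : Fin n) : coeff g i = 1 ∨ coeff g i = -1 := by
  rcases Int.units_eq_one_or (g.left (g.right i)) with h | h <;> simp [coeff, h]

theorem coeff_one (i : Fin n) : coeff (1 : SignedPerm n) i = 1 := by simp [coeff]

theorem swp_comm (i j : Fin n) : swp i j = swp j i := by
  simp [swp, Equiv.swap_comm i j]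

theorem swpBar_comm (i j : Fin n) : swpBar i j = swpBar j i := by
  simp [swpBar, Equiv.swap_comm i j, mul_comm]

theorem coeff_swp (i j k : Fin n) : coeff (swp i j) k = 1 := by simp [coeff, swp]

theorem swp_right (i j : Fin n) : (swp i j).right = Equiv.swap i j := rfl

theorem swpBar_right (i j : Fin n) : (swpBar i j).right = Equiv.swap i j := rfl

theorem tau_right (i : Fin n) : (tau i).right = 1 := rfl

theorem coeff_swpBar {i j : Fin n} (hij : i ≠ j) (k : Fin n) :
    coeff (swpBar i j) k = if k = i ∨ k = j then -1 else 1 := by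
  by_cases h1 : k = i
  · subst h1; simp [coeff, swpBar, hij.symm]
  · by_cases h2 : k = j
    · subst h2; simp [coeff, swpBar, hij]
    · simp [coeff, swpBar, h1, h2, Equiv.swap_apply_of_ne_of_ne]

theorem coeff_tau (i k : Fin n) : coeff (tau i) k = if k = i then -1 else 1 := by
  by_cases h1 : k = i
  · subst h1; simp [coeff, tau]
  · simp [coeff, tau, h1]

theorem signedPerm_ext {g h : SignedPerm n} (h1 : ∀ i, coeff g i = coeff h i)
    (h2 : ∀ i, g.right i = h.right i) : g = h := by
  have h3 : g.right = h.right := Equiv.ext h2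
  refine SemidirectProduct.ext (funext fun i => ?_) h3
  have := h1 (g.right⁻¹ i)
  simp only [coeff, ← h3] at this
  simpa [Units.ext_iff] using this

/-- Conjugation by `g` carries the reflection in `e_i ∓ e_j` to the one in `g e_i ∓ g e_j`. Hence
`swp` and `swpBar` keep their kind when `g` has equal signs at `i` and `j`, and are exchanged
otherwise. This lemma and the next three are the four cases. -/
theorem mul_swp_of_eq (g : SignedPerm n) {i j : Fin n} (hij : i ≠ j)
    (h : coeff g i * coeff g j = 1) :
    g * swp i j = swp (g.right i) (g.right j) * g := by
  have hc : coeff g i = coeff g j := by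
    rcases coeff_eq_or g i with h1 | h1 <;> rcases coeff_eq_or g j with h2 | h2 <;>
      rw [h1, h2] at h ⊢ <;> norm_num at h
  apply signedPerm_ext <;> intro k
  · simp only [coeff_mul, coeff_swp, swp_right, mul_one, one_mul]
    rcases eq_or_ne k i with rfl | h1
    · simp [hc]
    rcases eq_or_ne k j with rfl | h2
    · simp [hc]
    simp [Equiv.swap_apply_of_ne_of_ne h1 h2]
  · simp [swp_right, Equiv.swap_apply_def]
    split_ifs <;> rfl

theorem mul_swp_of_neg (g : SignedPerm n) {i j : Fin n} (hij : i ≠ j)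
    (h : coeff g i * coeff g j = -1) :
    g * swp i j = swpBar (g.right i) (g.right j) * g := by
  have hc : coeff g i = - coeff g j := by
    rcases coeff_eq_or g i with h1 | h1 <;> rcases coeff_eq_or g j with h2 | h2 <;>
      (revert h; rw [h1, h2]; norm_num)
  have hg : g.right i ≠ g.right j := by simpa using hij
  apply signedPerm_ext <;> intro k
  · simp only [coeff_mul, coeff_swp, swp_right, mul_one, coeff_swpBar hg]
    rcases eq_or_ne k i with rfl | h1
    · simp [hc]
    rcases eq_or_ne k j with rfl | h2
    · simp [hc]
    simp [Equiv.swap_apply_of_ne_of_ne h1 h2, h1, h2]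
  · simp [swp_right, swpBar_right, Equiv.swap_apply_def]
    split_ifs <;> rfl

theorem mul_swpBar_of_eq (g : SignedPerm n) {i j : Fin n} (hij : i ≠ j)
    (h : coeff g i * coeff g j = 1) :
    g * swpBar i j = swpBar (g.right i) (g.right j) * g := by
  have hc : coeff g i = coeff g j := by
    rcases coeff_eq_or g i with h1 | h1 <;> rcases coeff_eq_or g j with h2 | h2 <;>
      rw [h1, h2] at h ⊢ <;> norm_num at h
  have hg : g.right i ≠ g.right j := by simpa using hij
  apply signedPerm_ext <;> intro k
  · simp only [coeff_mul, swpBar_right, coeff_swpBar hij, coeff_swpBar hg]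
    rcases eq_or_ne k i with rfl | h1
    · simp [hc]
    rcases eq_or_ne k j with rfl | h2
    · simp [hc]
    simp [Equiv.swap_apply_of_ne_of_ne h1 h2, h1, h2]
  · simp [swpBar_right, Equiv.swap_apply_def]
    split_ifs <;> rfl

theorem mul_swpBar_of_neg (g : SignedPerm n) {i j : Fin n} (hij : i ≠ j)
    (h : coeff g i * coeff g j = -1) :
    g * swpBar i j = swp (g.right i) (g.right j) * g := by
  have hc : coeff g i = - coeff g j := by
    rcases coeff_eq_or g i with h1 | h1 <;> rcases coeff_eq_or g j with h2 | h2 <;>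
      (revert h; rw [h1, h2]; norm_num)
  apply signedPerm_ext <;> intro k
  · simp only [coeff_mul, coeff_swp, swpBar_right, one_mul, coeff_swpBar hij]
    rcases eq_or_ne k i with rfl | h1
    · simp [hc]
    rcases eq_or_ne k j with rfl | h2
    · simp [hc]
    simp [Equiv.swap_apply_of_ne_of_ne h1 h2, h1, h2]
  · simp [swp_right, swpBar_right, Equiv.swap_apply_def]
    split_ifs <;> rfl

theorem mul_tau (g : SignedPerm n) (i : Fin n) : g * tau i = tau (g.right i) * g := by
  apply signedPerm_ext <;> intro k
  · simp only [coeff_mul, coeff_tau, tau_right, Equiv.Perm.coe_one, id]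
    by_cases h : k = i <;> simp [h]
  · simp [tau_right]

end SignedPerm

/-! ### The commutator elements in a general algebra -/

section Cross

variable {n : ℕ} {R : Type*} [Ring R] [Algebra ℂ R]

/-- The element `(1 + c_j c_i) s_{ij}`. -/
def pos (c : Fin n → R) (s : SignedPerm n → R) (j i : Fin n) : R := (1 + c j * c i) * s (swp j i)

/-- The element `(1 - c_j c_i) s̄_{ij}`. -/
def neg (c : Fin n → R) (s : SignedPerm n → R) (j i : Fin n) : R :=
  (1 - c j * c i) * s (swpBar j i)

/-- The common form of the commutator `[y_j, x_i]` in all types. -/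
def cross (u v : ℂ) (c : Fin n → R) (s : SignedPerm n → R) (j i : Fin n) : R :=
  if j = i then -(u • ∑ k ∈ Finset.univ.erase i, (pos c s k i + neg c s k i)) - v • s (tau i)
  else u • (pos c s j i - neg c s j i)

/-- The scalars are the values at `X j` of `diffPos i k`, `diffNeg i k` and `diffTau i`. In this
form a comparison with divided differences can be made term by term. -/
theorem cross_eq_sum (u v : ℂ) (c : Fin n → R) (s : SignedPerm n → R) (j i : Fin n) :
    cross u v c s j i = -(u • ∑ k ∈ Finset.univ.erase i,
      ((if j = i then 1 else if j = k then -1 else 0 : ℂ) • pos c s k i +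
        (if j = i then 1 else if j = k then 1 else 0 : ℂ) • neg c s k i) +
      v • (if j = i then 1 else 0 : ℂ) • s (tau i)) := by
  rw [cross]
  split_ifs with hji
  · simp only [one_smul, neg_add, sub_eq_add_neg]
  · have : ∀ k, ((if j = k then -1 else 0 : ℂ) • pos c s k i +
        (if j = k then 1 else 0 : ℂ) • neg c s k i) =
        if j = k then -(pos c s k i - neg c s k i) else 0 := by
      intro k
      split_ifs
      · rw [neg_one_smul, one_smul, neg_sub, sub_eq_add_neg, add_comm]
      · simp
    rw [Finset.sum_congr rfl fun k _ => this k, Finset.sum_ite_eq,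
      if_pos (Finset.mem_erase.2 ⟨hji, Finset.mem_univ j⟩), zero_smul, smul_zero, add_zero,
      smul_neg, neg_neg]

/-- `W`-equivariant Clifford generators. The family `s` is indexed by all signed permutations, and
is multiplicative as far as one of the factors lies in `W`; it may vanish outside `W`. -/
structure CliffordData (W : Subgroup (SignedPerm n)) (c : Fin n → R) (s : SignedPerm n → R) :
    Prop where
  c_sq : ∀ i, c i * c i = 1
  c_anti : ∀ i j, i ≠ j → c i * c j = -(c j * c i)
  s_c : ∀ g i, s g * c i = coeff g i • (c (g.right i) * s g)
  s_one : s 1 = 1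
  mul_left : ∀ g ∈ W, ∀ h, s g * s h = s (g * h)
  mul_right : ∀ g ∈ W, ∀ h, s h * s g = s (h * g)

/-- The sign `x_i` and `c_l` commute with. -/
def sgn (i l : Fin n) : ℂ := if i = l then -1 else 1

namespace CliffordData

variable {W : Subgroup (SignedPerm n)} {c : Fin n → R} {s : SignedPerm n → R}

theorem c_c_mul (h : CliffordData W c s) (i : Fin n) (a : R) : c i * (c i * a) = a := by
  rw [← mul_assoc, h.c_sq, one_mul]

/-- Conjugation by `1 + c_k c_i` is a quarter turn sending `c_i` to `c_k` and `c_k` to `-c_i`.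
Composed with the transposition it leaves only the sign change at `i`, which is also how `x_i` acts
on the `c_l`. -/
theorem pos_mul_c (h : CliffordData W c s) {k i : Fin n} (hki : k ≠ i) (l : Fin n) :
    pos c s k i * c l = sgn i l • (c l * pos c s k i) := by
  have e := h.s_c (swp k i) l
  rw [coeff_swp, one_smul, swp_right] at e
  rw [pos, mul_assoc, e]
  rcases eq_or_ne l i with rfl | hli
  · rw [Equiv.swap_apply_right, sgn, if_pos rfl]
    have a := h.c_anti k l hki
    have b : c l * (c k * (c l * s (swp k l))) = - (c k * s (swp k l)) := by
      rw [← mul_assoc, h.c_anti l k hki.symm, neg_mul, mul_assoc, h.c_c_mul]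
    have b' : c k * (c l * (c k * s (swp k l))) = - (c l * s (swp k l)) := by
      rw [← mul_assoc, a, neg_mul, mul_assoc, h.c_c_mul]
    simp only [mul_add, add_mul, one_mul, mul_assoc, b, b', neg_smul, one_smul]
    abel
  rcases eq_or_ne l k with rfl | hlk
  · rw [Equiv.swap_apply_left, sgn, if_neg hki.symm]
    simp only [mul_add, add_mul, one_mul, mul_assoc, h.c_c_mul, one_smul]
    abel
  · rw [Equiv.swap_apply_of_ne_of_ne hlk hli, sgn, if_neg hli.symm, one_smul,
      ← mul_assoc, ← mul_assoc]
    congr 1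
    rw [add_mul, mul_add, mul_one, one_mul, mul_assoc, h.c_anti i l hli.symm, mul_neg,
      ← mul_assoc, h.c_anti k l hlk.symm, neg_mul, neg_neg, mul_assoc]

/-- The factor `1 - c_k c_i` gives the inverse quarter turn, and the two signs of `swpBar`
compensate for it, so the result is again the sign change at `i` alone. -/
theorem neg_mul_c (h : CliffordData W c s) {k i : Fin n} (hki : k ≠ i) (l : Fin n) :
    neg c s k i * c l = sgn i l • (c l * neg c s k i) := by
  have e := h.s_c (swpBar k i) l
  rw [coeff_swpBar hki, swpBar_right] at e
  rw [neg, mul_assoc, e]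
  rcases eq_or_ne l i with rfl | hli
  · rw [Equiv.swap_apply_right, sgn, if_pos rfl, if_pos (Or.inr rfl)]
    have b : c l * (c k * (c l * s (swpBar k l))) = - (c k * s (swpBar k l)) := by
      rw [← mul_assoc, h.c_anti l k hki.symm, neg_mul, mul_assoc, h.c_c_mul]
    have b' : c k * (c l * (c k * s (swpBar k l))) = - (c l * s (swpBar k l)) := by
      rw [← mul_assoc, h.c_anti k l hki, neg_mul, mul_assoc, h.c_c_mul]
    simp only [mul_sub, sub_mul, one_mul, mul_assoc, b, b', neg_smul, one_smul, mul_neg]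
    abel
  rcases eq_or_ne l k with rfl | hlk
  · rw [Equiv.swap_apply_left, sgn, if_neg hki.symm, if_pos (Or.inl rfl)]
    simp only [mul_sub, sub_mul, one_mul, mul_assoc, h.c_c_mul, one_smul, neg_smul, mul_neg]
    abel
  · rw [Equiv.swap_apply_of_ne_of_ne hlk hli, sgn, if_neg hli.symm, one_smul,
      if_neg (by tauto), one_smul, ← mul_assoc, ← mul_assoc]
    congr 1
    rw [sub_mul, mul_sub, mul_one, one_mul, mul_assoc, h.c_anti i l hli.symm, mul_neg,
      ← mul_assoc, h.c_anti k l hlk.symm, neg_mul, neg_neg, mul_assoc]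

theorem tau_mul_c (h : CliffordData W c s) (i l : Fin n) :
    s (tau i) * c l = sgn i l • (c l * s (tau i)) := by
  rw [h.s_c, coeff_tau, tau_right, sgn]
  simp only [eq_comm, Equiv.Perm.coe_one, id]

/-- Since `y_j` commutes with `c_l`, the commutator `[y_j, x_i]` has to pass `c_l` with the same
sign as `x_i`; each summand does. -/
theorem cross_mul_c (h : CliffordData W c s) (u v : ℂ) (j i l : Fin n) :
    cross u v c s j i * c l = sgn i l • (c l * cross u v c s j i) := by
  unfold cross
  split_ifs with hji
  · rw [sub_mul, neg_mul, smul_mul_assoc, smul_mul_assoc, h.tau_mul_c, Finset.sum_mul,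
      Finset.sum_congr rfl fun k hk => by
        rw [add_mul, h.pos_mul_c (Finset.ne_of_mem_erase hk),
          h.neg_mul_c (Finset.ne_of_mem_erase hk), ← smul_add, ← mul_add],
      ← Finset.smul_sum, ← Finset.mul_sum, mul_sub, mul_neg, mul_smul_comm, mul_smul_comm,
      smul_sub, smul_neg, smul_comm u, smul_comm v]
  · rw [smul_mul_assoc, sub_mul, h.pos_mul_c hji, h.neg_mul_c hji, mul_smul_comm, mul_sub,
      ← smul_sub, smul_comm u]

theorem s_mul_pos (h : CliffordData W c s) {g : SignedPerm n} (hg : g ∈ W) {k i : Fin n}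
    (hki : k ≠ i) :
    s g * pos c s k i = (if coeff g k * coeff g i = 1 then pos c s (g.right k) (g.right i)
      else neg c s (g.right k) (g.right i)) * s g := by
  have e : s g * (1 + c k * c i) =
      (1 + (coeff g k * coeff g i) • (c (g.right k) * c (g.right i))) * s g := by
    rw [mul_add, mul_one, ← mul_assoc, h.s_c, smul_mul_assoc, mul_assoc, h.s_c, mul_smul_comm,
      smul_smul, add_mul, one_mul, smul_mul_assoc, mul_assoc]
  rw [pos, ← mul_assoc, e, mul_assoc, h.mul_left g hg]
  split_ifs with hh
  · rw [hh, one_smul, mul_swp_of_eq g hki hh, ← h.mul_right g hg, pos, mul_assoc]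
  · have hh' : coeff g k * coeff g i = -1 := by
      rcases coeff_eq_or g k with h1 | h1 <;> rcases coeff_eq_or g i with h2 | h2 <;>
        simp [h1, h2] at hh ⊢
    rw [hh', neg_smul, one_smul, mul_swp_of_neg g hki hh', ← h.mul_right g hg, neg, mul_assoc,
      sub_eq_add_neg]

theorem s_mul_neg (h : CliffordData W c s) {g : SignedPerm n} (hg : g ∈ W) {k i : Fin n}
    (hki : k ≠ i) :
    s g * neg c s k i = (if coeff g k * coeff g i = 1 then neg c s (g.right k) (g.right i)
      else pos c s (g.right k) (g.right i)) * s g := by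
  have e : s g * (1 - c k * c i) =
      (1 - (coeff g k * coeff g i) • (c (g.right k) * c (g.right i))) * s g := by
    rw [mul_sub, mul_one, ← mul_assoc, h.s_c, smul_mul_assoc, mul_assoc, h.s_c, mul_smul_comm,
      smul_smul, sub_mul, one_mul, smul_mul_assoc, mul_assoc]
  rw [neg, ← mul_assoc, e, mul_assoc, h.mul_left g hg]
  split_ifs with hh
  · rw [hh, one_smul, mul_swpBar_of_eq g hki hh, ← h.mul_right g hg, neg, mul_assoc]
  · have hh' : coeff g k * coeff g i = -1 := by
      rcases coeff_eq_or g k with h1 | h1 <;> rcases coeff_eq_or g i with h2 | h2 <;>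
        simp [h1, h2] at hh ⊢
    rw [hh', neg_smul, one_smul, mul_swpBar_of_neg g hki hh', ← h.mul_right g hg, pos, mul_assoc,
      sub_neg_eq_add]

/-- Opposite signs of `g` exchange `pos` and `neg`. The diagonal value contains their sums, which do
not change; the off-diagonal one is their difference, which changes sign exactly as `coeff g j *
coeff g i` requires. -/
theorem s_mul_cross (h : CliffordData W c s) (u v : ℂ) {g : SignedPerm n} (hg : g ∈ W)
    (j i : Fin n) :
    s g * cross u v c s j i =
      (coeff g j * coeff g i) • (cross u v c s (g.right j) (g.right i) * s g) := by
  unfold cross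
  by_cases hji : j = i
  · subst hji
    rw [if_pos rfl, if_pos rfl, coeff_sq, one_smul, mul_sub, mul_neg, mul_smul_comm,
      mul_smul_comm, h.mul_left g hg, mul_tau, ← h.mul_right g hg, Finset.mul_sum, sub_mul,
      neg_mul, smul_mul_assoc, smul_mul_assoc, Finset.sum_mul]
    congr 3
    refine Finset.sum_bij (fun k _ => g.right k) (by simp) (by simp) ?_ ?_
    · intro b hb
      refine ⟨g.right⁻¹ b, ?_, by simp⟩
      simp only [Finset.mem_erase, Finset.mem_univ, and_true] at hb ⊢
      rintro rfl
      simp at hb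
    · intro k hk
      have hk' := Finset.ne_of_mem_erase hk
      rw [mul_add, h.s_mul_pos hg hk', h.s_mul_neg hg hk', ← add_mul]
      split_ifs
      · rfl
      · rw [add_comm]
  · have hg' : g.right j ≠ g.right i := by simpa using hji
    rw [if_neg hji, if_neg hg', mul_smul_comm, mul_sub, h.s_mul_pos hg hji, h.s_mul_neg hg hji,
      smul_mul_assoc, ← sub_mul, smul_comm]
    split_ifs with hh
    · rw [hh, one_smul]
    · have hh' : coeff g j * coeff g i = -1 := by
        rcases coeff_eq_or g j with h1 | h1 <;> rcases coeff_eq_or g i with h2 | h2 <;>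
          simp [h1, h2] at hh ⊢
      rw [hh', neg_smul, one_smul, ← neg_mul, neg_sub]

end CliffordData

/-- Elements `x_i` on which the Clifford generators and the group act as in the algebra. -/
structure PositionData (c : Fin n → R) (s : SignedPerm n → R) (x : Fin n → R) : Prop where
  x_c : ∀ i l, x i * c l = sgn i l • (c l * x i)
  s_x : ∀ g i, s g * x i = coeff g i • (x (g.right i) * s g)

namespace PositionData

variable {W : Subgroup (SignedPerm n)} {c : Fin n → R} {s : SignedPerm n → R} {x : Fin n → R}

theorem of_relations (h1 : ∀ i, x i * c i = -(c i * x i))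
    (h2 : ∀ i l, i ≠ l → x i * c l = c l * x i)
    (h3 : ∀ g i, s g * x i = coeff g i • (x (g.right i) * s g)) : PositionData c s x where
  x_c i l := by
    rw [sgn]
    split_ifs with h
    · rw [← h, h1, neg_one_smul]
    · rw [h2 i l h, one_smul]
  s_x := h3

theorem x_mul_c_c (hx : PositionData c s x) (i k l : Fin n) :
    x i * (c k * c l) = (sgn i k * sgn i l) • (c k * c l * x i) := by
  rw [← mul_assoc, hx.x_c, smul_mul_assoc, mul_assoc, hx.x_c, mul_smul_comm, smul_smul, mul_assoc]

theorem pos_comm_of_ne (hx : PositionData c s x) {k i l : Fin n} (hk : l ≠ k) (hi : l ≠ i) :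
    pos c s k i * x l = x l * pos c s k i := by
  rw [pos, mul_assoc, hx.s_x, coeff_swp, one_smul, swp_right, Equiv.swap_apply_of_ne_of_ne hk hi,
    ← mul_assoc, ← mul_assoc, add_mul, mul_add, hx.x_mul_c_c]
  simp [sgn, hk, hi]

theorem neg_comm_of_ne (hx : PositionData c s x) {k i l : Fin n} (hki : k ≠ i) (hk : l ≠ k)
    (hi : l ≠ i) :
    neg c s k i * x l = x l * neg c s k i := by
  rw [neg, mul_assoc, hx.s_x, coeff_swpBar hki, if_neg (by tauto), one_smul, swpBar_right,
    Equiv.swap_apply_of_ne_of_ne hk hi,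
    ← mul_assoc, ← mul_assoc, sub_mul, mul_sub, hx.x_mul_c_c]
  simp [sgn, hk, hi]

theorem tau_comm_of_ne (hx : PositionData c s x) {i l : Fin n} (hi : l ≠ i) :
    s (tau i) * x l = x l * s (tau i) := by
  rw [hx.s_x, coeff_tau, if_neg hi, one_smul, tau_right, Equiv.Perm.coe_one, id]

theorem pos_mul_x_left (hx : PositionData c s x) (k i : Fin n) :
    pos c s k i * x k = (1 + c k * c i) * x i * s (swp k i) := by
  rw [pos, mul_assoc, hx.s_x, coeff_swp, one_smul, swp_right, Equiv.swap_apply_left, mul_assoc]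

theorem pos_mul_x_right (hx : PositionData c s x) (k i : Fin n) :
    pos c s k i * x i = (1 + c k * c i) * x k * s (swp k i) := by
  rw [pos, mul_assoc, hx.s_x, coeff_swp, one_smul, swp_right, Equiv.swap_apply_right, mul_assoc]

theorem x_mul_pos_left (hx : PositionData c s x) {k i : Fin n} (hki : k ≠ i) :
    x k * pos c s k i = (1 - c k * c i) * x k * s (swp k i) := by
  rw [pos, ← mul_assoc, mul_add, hx.x_mul_c_c]
  simp [sgn, hki, add_mul, sub_eq_add_neg]

theorem x_mul_pos_right (hx : PositionData c s x) {k i : Fin n} (hki : k ≠ i) :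
    x i * pos c s k i = (1 - c k * c i) * x i * s (swp k i) := by
  rw [pos, ← mul_assoc, mul_add, hx.x_mul_c_c]
  simp [sgn, hki.symm, add_mul, sub_eq_add_neg]

theorem neg_mul_x_left (hx : PositionData c s x) {k i : Fin n} (hki : k ≠ i) :
    neg c s k i * x k = -((1 - c k * c i) * x i * s (swpBar k i)) := by
  rw [neg, mul_assoc, hx.s_x, coeff_swpBar hki, if_pos (Or.inl rfl), neg_smul, one_smul,
    swpBar_right, Equiv.swap_apply_left, mul_assoc, mul_neg]

theorem neg_mul_x_right (hx : PositionData c s x) {k i : Fin n} (hki : k ≠ i) :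
    neg c s k i * x i = -((1 - c k * c i) * x k * s (swpBar k i)) := by
  rw [neg, mul_assoc, hx.s_x, coeff_swpBar hki, if_pos (Or.inr rfl), neg_smul, one_smul,
    swpBar_right, Equiv.swap_apply_right, mul_assoc, mul_neg]

theorem x_mul_neg_left (hx : PositionData c s x) {k i : Fin n} (hki : k ≠ i) :
    x k * neg c s k i = (1 + c k * c i) * x k * s (swpBar k i) := by
  rw [neg, ← mul_assoc, mul_sub, hx.x_mul_c_c]
  simp [sgn, hki, add_mul]

theorem x_mul_neg_right (hx : PositionData c s x) {k i : Fin n} (hki : k ≠ i) :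
    x i * neg c s k i = (1 + c k * c i) * x i * s (swpBar k i) := by
  rw [neg, ← mul_assoc, mul_sub, hx.x_mul_c_c]
  simp [sgn, hki.symm, add_mul]

/-- Moving `x` past `1 + c_j c_i` flips the sign of `c_j c_i`, and so does exchanging `i` and `j`.
All four products thus acquire the same normal form, with the group element on the right. -/
theorem pos_sub_pos (h : CliffordData W c s) (hx : PositionData c s x) {i j : Fin n}
    (hij : i ≠ j) :
    pos c s j i * x j - x j * pos c s j i = x i * pos c s i j - pos c s i j * x i := by
  rw [hx.pos_mul_x_left, hx.x_mul_pos_left hij.symm, hx.x_mul_pos_left hij, hx.pos_mul_x_left,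
    swp_comm j i, h.c_anti j i hij.symm, sub_neg_eq_add, ← sub_eq_add_neg]

theorem neg_sub_neg (h : CliffordData W c s) (hx : PositionData c s x) {i j : Fin n}
    (hij : i ≠ j) :
    neg c s j i * x j - x j * neg c s j i = neg c s i j * x i - x i * neg c s i j := by
  rw [hx.neg_mul_x_left hij.symm, hx.x_mul_neg_left hij.symm, hx.x_mul_neg_left hij,
    hx.neg_mul_x_left hij,
    swpBar_comm j i, h.c_anti j i hij.symm, sub_neg_eq_add, ← sub_eq_add_neg]
  abel

/-- In the diagonal sum only the term with `k = j` fails to commute with `x_j`. The off-diagonal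
`cross` on the right consists of the matching pair, with the signs given by `pos_sub_pos` and
`neg_sub_neg`. -/
theorem cross_self_comm (h : CliffordData W c s) (hx : PositionData c s x) (u v : ℂ)
    {i j : Fin n} (hij : i ≠ j) :
    cross u v c s i i * x j - x j * cross u v c s i i =
      cross u v c s i j * x i - x i * cross u v c s i j := by
  have e : cross u v c s i i * x j - x j * cross u v c s i i =
      -(u • ((pos c s j i + neg c s j i) * x j - x j * (pos c s j i + neg c s j i))) := by
    rw [cross, if_pos rfl, ← Finset.add_sum_erase _ _
      (Finset.mem_erase.2 ⟨hij.symm, Finset.mem_univ j⟩)]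
    have e1 : (∑ k ∈ (Finset.univ.erase i).erase j, (pos c s k i + neg c s k i)) * x j =
        x j * ∑ k ∈ (Finset.univ.erase i).erase j, (pos c s k i + neg c s k i) := by
      rw [Finset.sum_mul, Finset.mul_sum]
      refine Finset.sum_congr rfl fun k hk => ?_
      obtain ⟨h1, h2⟩ := Finset.mem_erase.1 hk
      have h3 := Finset.ne_of_mem_erase h2
      rw [add_mul, mul_add, hx.pos_comm_of_ne h1.symm hij.symm,
        hx.neg_comm_of_ne h3 h1.symm hij.symm]
    rw [sub_mul, mul_sub, smul_mul_assoc, hx.tau_comm_of_ne hij.symm, mul_smul_comm,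
      sub_sub_sub_cancel_right, neg_mul, mul_neg, smul_mul_assoc, mul_smul_comm, add_mul, mul_add,
      e1, smul_sub, smul_add, smul_add]
    abel
  rw [e, cross, if_neg hij]
  have h1 := pos_sub_pos h hx hij
  have h2 := neg_sub_neg h hx hij
  rw [smul_mul_assoc, mul_smul_comm, ← smul_sub, ← smul_neg]
  congr 1
  rw [add_mul, mul_add, add_sub_add_comm, h1, h2, sub_mul, mul_sub]
  abel

/-- This is what the Jacobi identity for `y_k`, `x_i`, `x_j` demands when `x_i` and `x_j` commute.
For three distinct indices both sides vanish. -/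
theorem cross_comm (h : CliffordData W c s) (hx : PositionData c s x) (u v : ℂ)
    {i j : Fin n} (k : Fin n) (hij : i ≠ j) :
    cross u v c s k i * x j - x j * cross u v c s k i =
      cross u v c s k j * x i - x i * cross u v c s k j := by
  rcases eq_or_ne k i with rfl | hki
  · exact cross_self_comm h hx u v hij
  rcases eq_or_ne k j with rfl | hkj
  · exact (cross_self_comm h hx u v hij.symm).symm
  rw [cross, cross, if_neg hki, if_neg hkj]
  simp only [smul_mul_assoc, mul_smul_comm, sub_mul, mul_sub, hx.pos_comm_of_ne hkj.symm hij.symm,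
    hx.neg_comm_of_ne hki hkj.symm hij.symm, hx.pos_comm_of_ne hki.symm hij,
    hx.neg_comm_of_ne hkj hki.symm hij, sub_self]

/-- The commutator of `y_j` with `x_k ^ 2`. -/
def _root_.Dahca.anti (u v : ℂ) (c : Fin n → R) (s : SignedPerm n → R) (x : Fin n → R)
    (j k : Fin n) : R :=
  cross u v c s j k * x k + x k * cross u v c s j k

/-- The `τ_j` term drops out because `τ_j` anticommutes with `x_j`. The remaining terms pair off
under exchange of `j` and `k`, `pos` without a sign and `neg` with one, which matches the difference
in the off-diagonal commutator. -/
theorem anti_self (h : CliffordData W c s) (hx : PositionData c s x) (u v : ℂ) (j : Fin n) :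
    anti u v c s x j j = (-1 : ℂ) • ∑ k ∈ Finset.univ.erase j, anti u v c s x j k := by
  have e1 : ∀ k ≠ j, pos c s k j * x j + x j * pos c s k j =
      pos c s j k * x k + x k * pos c s j k := by
    intro k hk
    rw [hx.pos_mul_x_right, hx.x_mul_pos_right hk, hx.pos_mul_x_right, hx.x_mul_pos_right hk.symm,
      swp_comm j k, h.c_anti j k hk.symm, sub_neg_eq_add, ← sub_eq_add_neg, add_comm]
  have e2 : ∀ k ≠ j, neg c s k j * x j + x j * neg c s k j =
      -(neg c s j k * x k + x k * neg c s j k) := by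
    intro k hk
    rw [hx.neg_mul_x_right hk, hx.x_mul_neg_right hk, hx.neg_mul_x_right hk.symm,
      hx.x_mul_neg_right hk.symm,
      swpBar_comm j k, h.c_anti j k hk.symm, sub_neg_eq_add, ← sub_eq_add_neg]
    abel
  have e3 : s (tau j) * x j + x j * s (tau j) = 0 := by
    rw [hx.s_x, coeff_tau, if_pos rfl, tau_right, neg_smul, one_smul, Equiv.Perm.coe_one, id,
      neg_add_cancel]
  have e4 : anti u v c s x j j = -(u • ∑ k ∈ Finset.univ.erase j,
      ((pos c s k j * x j + x j * pos c s k j) + (neg c s k j * x j + x j * neg c s k j))) -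
      v • (s (tau j) * x j + x j * s (tau j)) := by
    simp only [anti, cross, if_true, sub_mul, mul_sub, neg_mul, mul_neg, smul_mul_assoc,
      mul_smul_comm, Finset.sum_mul, Finset.mul_sum]
    simp only [add_mul, mul_add, Finset.sum_add_distrib, smul_add]
    abel
  rw [e4, e3, smul_zero, sub_zero, neg_one_smul, Finset.smul_sum]
  congr 1
  refine Finset.sum_congr rfl fun k hk => ?_
  have hk := Finset.ne_of_mem_erase hk
  rw [e1 k hk, e2 k hk, anti, cross, if_neg hk.symm, smul_mul_assoc, mul_smul_comm, ← smul_add,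
    sub_mul, mul_sub]
  congr 1
  abel

end PositionData

end Cross

/-! ### Divided differences -/

section DivDiff

variable {n : ℕ}

theorem polyAct_X (g : SignedPerm n) (i : Fin n) :
    polyAct g (X i) = coeff g i • X (g.right i) := by
  simp [polyAct]

theorem polyAct_mul (g h : SignedPerm n) : polyAct (g * h) = (polyAct g).comp (polyAct h) := by
  ext1 i
  simp [polyAct_X, coeff_mul, smul_smul, mul_comm]

theorem polyAct_one : polyAct (1 : SignedPerm n) = AlgHom.id ℂ _ := by
  ext1 i
  simp [polyAct_X, coeff_one]

open Classical in
/-- The linear operator `f ↦ (f - σ f) / a`, where `a` divides all `f - σ f`. -/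
def divDiff (σ : MvPolynomial (Fin n) ℂ →ₐ[ℂ] MvPolynomial (Fin n) ℂ)
    (a : MvPolynomial (Fin n) ℂ) : MvPolynomial (Fin n) ℂ →ₗ[ℂ] MvPolynomial (Fin n) ℂ :=
  if h : a ≠ 0 ∧ ∀ f, a ∣ f - σ f then
    { toFun := fun f => (h.2 f).choose
      map_add' := fun f g => mul_left_cancel₀ h.1 <| by
        rw [← (h.2 (f + g)).choose_spec, mul_add, ← (h.2 f).choose_spec, ← (h.2 g).choose_spec,
          map_add]
        ring
      map_smul' := fun r f => mul_left_cancel₀ h.1 <| by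
        rw [← (h.2 (r • f)).choose_spec, RingHom.id_apply, mul_smul_comm,
          ← (h.2 f).choose_spec, map_smul, smul_sub] }
  else 0

variable {σ : MvPolynomial (Fin n) ℂ →ₐ[ℂ] MvPolynomial (Fin n) ℂ} {a : MvPolynomial (Fin n) ℂ}

theorem dvd_sub_of_forall_X (h : ∀ i, a ∣ X i - σ (X i)) (f : MvPolynomial (Fin n) ℂ) :
    a ∣ f - σ f := by
  induction f using MvPolynomial.induction_on with
  | C r => rw [← MvPolynomial.algebraMap_eq, AlgHom.commutes, sub_self]; exact dvd_zero a
  | add p q hp hq => rw [map_add, add_sub_add_comm]; exact dvd_add hp hq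
  | mul_X p i hp =>
    rw [map_mul, show p * X i - σ p * σ (X i) = (p - σ p) * X i + σ p * (X i - σ (X i)) by ring]
    exact dvd_add (hp.mul_right _) ((h i).mul_left _)

theorem mul_divDiff (ha : a ≠ 0) (h : ∀ i, a ∣ X i - σ (X i)) (f : MvPolynomial (Fin n) ℂ) :
    a * divDiff σ a f = f - σ f := by
  have h' : a ≠ 0 ∧ ∀ f, a ∣ f - σ f := ⟨ha, dvd_sub_of_forall_X h⟩
  rw [divDiff, dif_pos h']
  exact ((h'.2 f).choose_spec).symm

theorem divDiff_eq_of_mul_eq (ha : a ≠ 0) (h : ∀ i, a ∣ X i - σ (X i))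
    {f b : MvPolynomial (Fin n) ℂ} (hb : a * b = f - σ f) : divDiff σ a f = b :=
  mul_left_cancel₀ ha <| by rw [mul_divDiff ha h, hb]

/-- The twisted Leibniz rule. No divisibility is assumed, since the default value of `divDiff` is
the zero operator. -/
theorem divDiff_mul (f g : MvPolynomial (Fin n) ℂ) :
    divDiff σ a (f * g) = divDiff σ a f * σ g + f * divDiff σ a g := by
  by_cases h : a ≠ 0 ∧ ∀ f, a ∣ f - σ f
  · have hd := mul_divDiff h.1 fun i => h.2 (X i)
    apply mul_left_cancel₀ h.1
    rw [mul_add, hd, ← mul_assoc, hd, mul_left_comm, hd, map_mul]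
    ring
  · simp [divDiff, dif_neg h]

theorem divDiff_eq_zero {f : MvPolynomial (Fin n) ℂ} (hf : σ f = f) : divDiff σ a f = 0 := by
  by_cases h : a ≠ 0 ∧ ∀ f, a ∣ f - σ f
  · apply mul_left_cancel₀ h.1
    rw [mul_divDiff h.1 fun i => h.2 (X i), hf, sub_self, mul_zero]
  · simp [divDiff, dif_neg h]

theorem divDiff_one : divDiff σ a 1 = 0 := divDiff_eq_zero (map_one σ)

/-- The divided difference along the reflection `s_{ki}`. -/
def diffPos (i k : Fin n) : MvPolynomial (Fin n) ℂ →ₗ[ℂ] MvPolynomial (Fin n) ℂ :=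
  divDiff (polyAct (swp k i)) (X i - X k)

/-- The divided difference along the reflection `s̄_{ki}`. -/
def diffNeg (i k : Fin n) : MvPolynomial (Fin n) ℂ →ₗ[ℂ] MvPolynomial (Fin n) ℂ :=
  divDiff (polyAct (swpBar k i)) (X i + X k)

/-- The divided difference along the reflection `τ_i`. -/
def diffTau (i : Fin n) : MvPolynomial (Fin n) ℂ →ₗ[ℂ] MvPolynomial (Fin n) ℂ :=
  divDiff (polyAct (tau i)) (X i + X i)

theorem X_sub_X_ne_zero {i k : Fin n} (h : k ≠ i) : (X i - X k : MvPolynomial (Fin n) ℂ) ≠ 0 :=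
  sub_ne_zero.2 fun e => h (X_injective e).symm

theorem X_add_X_ne_zero (i k : Fin n) : (X i + X k : MvPolynomial (Fin n) ℂ) ≠ 0 := by
  intro h
  have := congrArg (eval fun _ => (1 : ℂ)) h
  norm_num at this

theorem diffPos_X {i k : Fin n} (h : k ≠ i) (l : Fin n) :
    diffPos i k (X l) = C (if l = i then 1 else if l = k then -1 else 0) := by
  have key : ∀ l : Fin n, (X i - X k : MvPolynomial (Fin n) ℂ) *
      C (if l = i then 1 else if l = k then -1 else 0) = X l - polyAct (swp k i) (X l) := by
    intro l
    rw [polyAct_X, coeff_swp, one_smul, swp_right]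
    rcases eq_or_ne l i with rfl | h1
    · simp
    rcases eq_or_ne l k with rfl | h2
    · simp [h]
    simp [h1, h2, Equiv.swap_apply_of_ne_of_ne]
  exact divDiff_eq_of_mul_eq (X_sub_X_ne_zero h) (fun m => ⟨_, (key m).symm⟩) (key l)

theorem diffNeg_X {i k : Fin n} (h : k ≠ i) (l : Fin n) :
    diffNeg i k (X l) = C (if l = i then 1 else if l = k then 1 else 0) := by
  have key : ∀ l : Fin n, (X i + X k : MvPolynomial (Fin n) ℂ) *
      C (if l = i then 1 else if l = k then 1 else 0) = X l - polyAct (swpBar k i) (X l) := by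
    intro l
    rw [polyAct_X, coeff_swpBar h, swpBar_right]
    rcases eq_or_ne l i with rfl | h1
    · simp
    rcases eq_or_ne l k with rfl | h2
    · simp [add_comm]
    simp [h1, h2, Equiv.swap_apply_of_ne_of_ne]
  exact divDiff_eq_of_mul_eq (X_add_X_ne_zero i k) (fun m => ⟨_, (key m).symm⟩) (key l)

theorem diffTau_X (i l : Fin n) : diffTau i (X l) = C (if l = i then 1 else 0) := by
  have key : ∀ l : Fin n, (X i + X i : MvPolynomial (Fin n) ℂ) *
      C (if l = i then 1 else 0) = X l - polyAct (tau i) (X l) := by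
    intro l
    rw [polyAct_X, coeff_tau, tau_right]
    rcases eq_or_ne l i with rfl | h1
    · simp
    simp [h1]
  exact divDiff_eq_of_mul_eq (X_add_X_ne_zero i i) (fun m => ⟨_, (key m).symm⟩) (key l)

end DivDiff

/-! ### Dunkl operators on induced modules -/

section Dunkl

/-- The module induced from `M`, as a vector space: polynomials with coefficients in `M`. -/
def Ind (n : ℕ) (M : Type*) [AddCommGroup M] [Module ℂ M] : Type _ :=
  TensorProduct ℂ (MvPolynomial (Fin n) ℂ) M

variable {n : ℕ} {M : Type*} [AddCommGroup M] [Module ℂ M]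

instance : AddCommGroup (Ind n M) :=
  inferInstanceAs (AddCommGroup (TensorProduct ℂ (MvPolynomial (Fin n) ℂ) M))

instance : Module ℂ (Ind n M) :=
  inferInstanceAs (Module ℂ (TensorProduct ℂ (MvPolynomial (Fin n) ℂ) M))

/-- The pure tensors. -/
def tm : MvPolynomial (Fin n) ℂ →ₗ[ℂ] M →ₗ[ℂ] Ind n M :=
  TensorProduct.mk ℂ (MvPolynomial (Fin n) ℂ) M

/-- An endomorphism of the induced module made from its two factors. -/
def tens (f : Module.End ℂ (MvPolynomial (Fin n) ℂ)) (e : Module.End ℂ M) :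
    Module.End ℂ (Ind n M) := TensorProduct.map f e

@[simp]
theorem tens_tm (f : Module.End ℂ (MvPolynomial (Fin n) ℂ)) (e : Module.End ℂ M)
    (p : MvPolynomial (Fin n) ℂ) (m : M) : tens f e (tm p m) = tm (f p) (e m) := rfl

theorem end_ext {D D' : Module.End ℂ (Ind n M)} (h : ∀ p m, D (tm p m) = D' (tm p m)) : D = D' :=
  TensorProduct.ext' h

theorem tens_mul (f f' : Module.End ℂ (MvPolynomial (Fin n) ℂ)) (e e' : Module.End ℂ M) :
    tens f e * tens f' e' = tens (f * f') (e * e') :=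
  end_ext fun _ _ => rfl

theorem tens_one : tens (1 : Module.End ℂ (MvPolynomial (Fin n) ℂ)) (1 : Module.End ℂ M) = 1 :=
  end_ext fun _ _ => rfl

theorem tens_add (f : Module.End ℂ (MvPolynomial (Fin n) ℂ)) (e e' : Module.End ℂ M) :
    tens f (e + e') = tens f e + tens f e' :=
  end_ext fun _ _ => by simp

theorem tens_sub (f : Module.End ℂ (MvPolynomial (Fin n) ℂ)) (e e' : Module.End ℂ M) :
    tens f (e - e') = tens f e - tens f e' :=
  end_ext fun _ _ => by simp

theorem tens_neg_right (f : Module.End ℂ (MvPolynomial (Fin n) ℂ)) (e : Module.End ℂ M) :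
    tens f (-e) = -tens f e :=
  end_ext fun _ _ => by simp

theorem tens_zero (f : Module.End ℂ (MvPolynomial (Fin n) ℂ)) :
    tens f (0 : Module.End ℂ M) = 0 :=
  end_ext fun _ _ => by simp

theorem tens_smul (r : ℂ) (f : Module.End ℂ (MvPolynomial (Fin n) ℂ)) (e : Module.End ℂ M) :
    tens f (r • e) = r • tens f e :=
  end_ext fun _ _ => by simp

theorem smul_tens (r : ℂ) (f : Module.End ℂ (MvPolynomial (Fin n) ℂ)) (e : Module.End ℂ M) :
    tens (r • f) e = r • tens f e :=
  end_ext fun _ _ => by simp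

/-- Multiplication by the `i`-th variable. -/
def opY (i : Fin n) : Module.End ℂ (Ind n M) :=
  tens (LinearMap.mulLeft ℂ (X i)) 1

/-- The action of the Clifford generators. -/
def opC (c : Fin n → Module.End ℂ M) (i : Fin n) :
    Module.End ℂ (Ind n M) :=
  tens 1 (c i)

/-- The diagonal action of the group. -/
def opS (s : SignedPerm n → Module.End ℂ M) (g : SignedPerm n) :
    Module.End ℂ (Ind n M) :=
  tens (polyAct g).toLinearMap (s g)

/-- The Dunkl operators. -/
def opX (u v : ℂ) (c : Fin n → Module.End ℂ M) (s : SignedPerm n → Module.End ℂ M)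
    (x : Fin n → Module.End ℂ M) (i : Fin n) : Module.End ℂ (Ind n M) :=
  tens 1 (x i) + u • ∑ k ∈ Finset.univ.erase i,
    (tens (diffPos i k) (pos c s k i) + tens (diffNeg i k) (neg c s k i)) +
    v • tens (diffTau i) (s (tau i))

/-- The `opY j` generate the whole module from `1 ⊗ M`. Allowing `Y'` to differ from `opY` covers
relations with group elements, which permute the `y_j` up to sign. -/
theorem eq_zero_of_vacuum {D : Module.End ℂ (Ind n M)}
    (Y' : Fin n → Module.End ℂ (Ind n M))
    (hD : ∀ j, D * opY j = Y' j * D) (h0 : ∀ m, D (tm 1 m) = 0) : D = 0 := by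
  refine end_ext fun f m => ?_
  rw [LinearMap.zero_apply]
  induction f using MvPolynomial.induction_on with
  | C r => rw [← mul_one (C r), ← smul_eq_C_mul, map_smul, LinearMap.smul_apply, map_smul, h0,
      smul_zero]
  | add p q hp hq => rw [map_add, LinearMap.add_apply, map_add, hp, hq, add_zero]
  | mul_X p i hp =>
    have := LinearMap.congr_fun (hD i) (tm p m)
    simpa [opY, hp, mul_comm] using this

variable {W : Subgroup (SignedPerm n)} {c : Fin n → Module.End ℂ M}
  {s : SignedPerm n → Module.End ℂ M} {x : Fin n → Module.End ℂ M}

theorem opC_data (h : CliffordData W c s) : CliffordData W (opC c) (opS s) where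
  c_sq i := by rw [opC, tens_mul, h.c_sq, one_mul, tens_one]
  c_anti i j hij := by
    rw [opC, opC, tens_mul, tens_mul, h.c_anti i j hij, tens_neg_right]
  s_c g i := by
    rw [opC, opC, opS, tens_mul, tens_mul, h.s_c, mul_one, one_mul, tens_smul]
  s_one := by
    rw [opS, h.s_one, polyAct_one]
    exact tens_one
  mul_left g hg k := by
    rw [opS, opS, opS, tens_mul, h.mul_left g hg, polyAct_mul]; rfl
  mul_right g hg k := by
    rw [opS, opS, opS, tens_mul, h.mul_right g hg, polyAct_mul]; rfl

theorem opY_comm (i j : Fin n) :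
    (opY i * opY j : Module.End ℂ (Ind n M)) = opY j * opY i := by
  rw [opY, opY, tens_mul, tens_mul]
  congr 1
  refine LinearMap.ext fun f => ?_
  simp [mul_left_comm]

theorem opY_opC (i j : Fin n) : opY i * opC c j = opC c j * opY i := by
  rw [opY, opC, tens_mul, tens_mul, one_mul, one_mul, mul_one, mul_one]

theorem opS_opY (g : SignedPerm n) (i : Fin n) :
    opS s g * opY i = coeff g i • (opY (g.right i) * opS s g) := by
  rw [opS, opY, opY, tens_mul, tens_mul, one_mul, mul_one,
    ← smul_tens]
  congr 1
  refine LinearMap.ext fun f => ?_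
  simp [polyAct_X]

theorem tens_pos (k i : Fin n) :
    tens (polyAct (swp k i)).toLinearMap (pos c s k i) = pos (opC c) (opS s) k i := by
  rw [pos, pos, opC, opC, opS, tens_mul, add_mul, add_mul, tens_mul, one_mul, one_mul, one_mul,
    one_mul, tens_add]

theorem tens_neg (k i : Fin n) :
    tens (polyAct (swpBar k i)).toLinearMap (neg c s k i) = neg (opC c) (opS s) k i := by
  rw [neg, neg, opC, opC, opS, tens_mul, sub_mul, sub_mul, tens_mul, one_mul, one_mul, one_mul,
    one_mul, tens_sub]

/-- The Leibniz rule for `X j * f`: apart from `d • σ f`, the divided difference passes through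
multiplication by `X j`. -/
theorem opY_tens_divDiff {σ : MvPolynomial (Fin n) ℂ →ₐ[ℂ] MvPolynomial (Fin n) ℂ}
    {a : MvPolynomial (Fin n) ℂ} {j : Fin n} {d : ℂ} (hd : divDiff σ a (X j) = C d)
    (e : Module.End ℂ M) :
    opY j * tens (divDiff σ a) e - tens (divDiff σ a) e * opY j =
      -(d • tens σ.toLinearMap e) := by
  refine end_ext fun f m => ?_
  simp [opY, divDiff_mul, hd, ← smul_eq_C_mul]

/-- The Dunkl operators are built for this relation. It does not use any property of `c`, `s` or
`x`. -/
theorem cross_eq (u v : ℂ) (j i : Fin n) :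
    opY j * opX u v c s x i - opX u v c s x i * opY j = cross u v (opC c) (opS s) j i := by
  have e0 : opY j * tens 1 (x i) - tens 1 (x i) * opY j = 0 := by
    rw [opY, tens_mul, tens_mul, one_mul, one_mul, mul_one, mul_one, sub_self]
  have e1 : ∀ k ∈ Finset.univ.erase i,
      (opY j * (tens (diffPos i k) (pos c s k i) + tens (diffNeg i k) (neg c s k i)) -
      (tens (diffPos i k) (pos c s k i) + tens (diffNeg i k) (neg c s k i)) * opY j) =
      -((if j = i then 1 else if j = k then -1 else 0 : ℂ) • pos (opC c) (opS s) k i +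
        (if j = i then 1 else if j = k then 1 else 0 : ℂ) • neg (opC c) (opS s) k i) := by
    intro k hk
    have hk := Finset.ne_of_mem_erase hk
    rw [mul_add, add_mul, add_sub_add_comm, diffPos, diffNeg, opY_tens_divDiff (diffPos_X hk j),
      opY_tens_divDiff (diffNeg_X hk j), tens_pos, tens_neg, neg_add]
  have e2 := opY_tens_divDiff (diffTau_X i j) (s (tau i))
  rw [← diffTau] at e2
  have e3 : opY j * opX u v c s x i - opX u v c s x i * opY j =
      (opY j * tens 1 (x i) - tens 1 (x i) * opY j) + u • ∑ k ∈ Finset.univ.erase i,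
      (opY j * (tens (diffPos i k) (pos c s k i) + tens (diffNeg i k) (neg c s k i)) -
      (tens (diffPos i k) (pos c s k i) + tens (diffNeg i k) (neg c s k i)) * opY j) +
      v • (opY j * tens (diffTau i) (s (tau i)) - tens (diffTau i) (s (tau i)) * opY j) := by
    rw [opX, Finset.sum_sub_distrib, ← Finset.mul_sum, ← Finset.sum_mul]
    simp only [mul_add, add_mul, mul_smul_comm, smul_mul_assoc, smul_sub]
    abel
  rw [e3, e0, e2, Finset.sum_congr rfl e1, zero_add, cross_eq_sum, Finset.sum_neg_distrib,
    smul_neg, smul_neg, neg_add, opS]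

theorem opX_vacuum (u v : ℂ) (i : Fin n) (m : M) : opX u v c s x i (tm 1 m) = tm 1 (x i m) := by
  simp [opX, diffPos, diffNeg, diffTau, divDiff_one]

theorem opX_opC (h : CliffordData W c s) (hx : PositionData c s x) (u v : ℂ) (i l : Fin n) :
    opX u v c s x i * opC c l = sgn i l • (opC c l * opX u v c s x i) := by
  rw [← sub_eq_zero]
  refine eq_zero_of_vacuum opY (fun j => ?_) fun m => ?_
  · have e := cross_eq (c := c) (s := s) (x := x) u v j i
    have e2 := (opC_data h).cross_mul_c u v j i l
    rw [← e] at e2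
    have e3 := opY_opC (c := c) j l
    have e4 : opX u v c s x i * (opC c l * opY j) = opX u v c s x i * (opY j * opC c l) := by
      rw [e3]
    have e5 : opY j * (opC c l * opX u v c s x i) = opC c l * (opY j * opX u v c s x i) := by
      rw [← mul_assoc, e3, mul_assoc]
    simp only [sub_mul, mul_sub, smul_sub, smul_mul_assoc, mul_smul_comm, mul_assoc] at e2 ⊢
    rw [e4, e5]
    linear_combination (norm := module) (-1 : ℂ) • e2
  · have e := LinearMap.congr_fun (hx.x_c i l) m
    simp only [Module.End.mul_apply, LinearMap.smul_apply] at e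
    simp [opX_vacuum, opC, e]

theorem opS_opX (h : CliffordData W c s) (hx : PositionData c s x) (hs : ∀ g ∉ W, s g = 0)
    (u v : ℂ) (g : SignedPerm n) (i : Fin n) :
    opS s g * opX u v c s x i = coeff g i • (opX u v c s x (g.right i) * opS s g) := by
  by_cases hg : g ∈ W
  swap
  · rw [opS, hs g hg, tens_zero, zero_mul, mul_zero, smul_zero]
  rw [← sub_eq_zero]
  refine eq_zero_of_vacuum (fun j => coeff g j • opY (g.right j)) (fun j => ?_) fun m => ?_
  · have e1 := (opC_data h).s_mul_cross u v hg j i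
    rw [← cross_eq (x := x), ← cross_eq (x := x)] at e1
    have e2 := opS_opY (s := s) g j
    have e3 : opS s g * (opY j * opX u v c s x i) =
        coeff g j • (opY (g.right j) * (opS s g * opX u v c s x i)) := by
      rw [← mul_assoc, e2, smul_mul_assoc, mul_assoc]
    have e4 : opX u v c s x (g.right i) * opS s g * opY j =
        coeff g j • (opX u v c s x (g.right i) * opY (g.right j) * opS s g) := by
      rw [mul_assoc, e2, mul_smul_comm, mul_assoc]
    rw [mul_sub, e3, sub_mul, smul_sub, mul_assoc (opY (g.right j))] at e1
    rw [sub_mul, mul_assoc, smul_mul_assoc, e4, mul_sub, smul_mul_assoc, smul_mul_assoc,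
      mul_smul_comm, smul_smul, smul_smul, mul_comm (coeff g i)]
    linear_combination (norm := module) (-1 : ℂ) • e1
  · have e := LinearMap.congr_fun (hx.s_x g i) m
    simp only [Module.End.mul_apply, LinearMap.smul_apply] at e
    simp [opX_vacuum, opS, e]

theorem opX_data (h : CliffordData W c s) (hx : PositionData c s x) (hs : ∀ g ∉ W, s g = 0)
    (u v : ℂ) : PositionData (opC c) (opS s) (opX u v c s x) where
  x_c := opX_opC h hx u v
  s_x := opS_opX h hx hs u v

/-- The commutator of two Dunkl operators commutes with every `opY k` by the Jacobi identity and
`cross_comm`, and on `1 ⊗ M` it is the commutator of `x i` and `x j`, which is zero. -/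
theorem opX_comm (h : CliffordData W c s) (hx : PositionData c s x) (hs : ∀ g ∉ W, s g = 0)
    (hxx : ∀ i j, x i * x j = x j * x i) (u v : ℂ) (i j : Fin n) :
    opX u v c s x i * opX u v c s x j = opX u v c s x j * opX u v c s x i := by
  rcases eq_or_ne i j with rfl | hij
  · rfl
  rw [← sub_eq_zero]
  refine eq_zero_of_vacuum opY (fun k => ?_) fun m => ?_
  · have e := PositionData.cross_comm (opC_data h) (opX_data h hx hs u v) u v k hij
    rw [← cross_eq (x := x), ← cross_eq (x := x)] at e
    generalize opX u v c s x i = a at *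
    generalize opX u v c s x j = b at *
    generalize (opY k : Module.End ℂ (Ind n M)) = y at *
    rw [← sub_eq_zero] at e ⊢
    rw [← neg_eq_zero, ← e]
    noncomm_ring
  · have e := LinearMap.congr_fun (hxx i j) m
    simp only [Module.End.mul_apply] at e
    simp [opX_vacuum, e]

end Dunkl

/-! ### The uniform form of the defining relations -/

section Bracket

variable {n : ℕ}

/-- The parameter `u`. -/
def Datum.u : Datum → ℂ
  | .A u => u
  | .D u => u
  | .B u _ => u

/-- The coefficient of the sign changes in the commutators. -/
def Datum.v : Datum → ℂ
  | .A _ => 0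
  | .D _ => 0
  | .B _ v => ((Real.sqrt 2 : ℝ) : ℂ) * v

theorem swpBar_notMem_weylA {i j : Fin n} (hij : i ≠ j) : swpBar i j ∉ weylA n := by
  intro h
  have := h i
  simp [swpBar, hij] at this

open Classical in
/-- A family indexed by a subgroup, extended by zero. -/
def extend {R : Type*} [Zero R] {W : Subgroup (SignedPerm n)} (s : W → R) (g : SignedPerm n) : R :=
  if h : g ∈ W then s ⟨g, h⟩ else 0

theorem extend_of_mem {R : Type*} [Zero R] {W : Subgroup (SignedPerm n)} (s : W → R)
    {g : SignedPerm n} (h : g ∈ W) : extend s g = s ⟨g, h⟩ := dif_pos h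

theorem extend_of_notMem {R : Type*} [Zero R] {W : Subgroup (SignedPerm n)} (s : W → R)
    {g : SignedPerm n} (h : g ∉ W) : extend s g = 0 := dif_neg h

section

variable {R : Type*} [Ring R] [Algebra ℂ R]

theorem map_bracketA (u : ℂ)
    (F : FreeAlgebra ℂ (Gen (weylA n)) →ₐ[ℂ] R) (j i : Fin n) :
    F (bracketA n u j i) =
      cross u 0 (fun k => F (fc k)) (extend fun g => F (fw g)) j i := by
  have h1 := fun k l => extend_of_mem (fun g : weylA n => F (fw g)) (swp_mem_weylA k l)
  have h2 := fun k l (h : k ≠ l) => extend_of_notMem (fun g : weylA n => F (fw g))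
    (swpBar_notMem_weylA h)
  simp only [bracketA, cross, pos, neg]
  split_ifs with hji
  · rw [zero_smul, sub_zero, map_neg, map_smul, map_sum]
    congr 2
    refine Finset.sum_congr rfl fun k hk => ?_
    rw [h1, h2 k i (Finset.ne_of_mem_erase hk)]
    simp
  · rw [h1, h2 j i hji]
    simp


theorem map_bracketD (u : ℂ)
    (F : FreeAlgebra ℂ (Gen (weylD n)) →ₐ[ℂ] R) (j i : Fin n) :
    F (bracketD n u j i) =
      cross u 0 (fun k => F (fc k)) (extend fun g => F (fw g)) j i := by
  have h1 := fun k l => extend_of_mem (fun g : weylD n => F (fw g)) (swp_mem_weylD k l)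
  have h2 := fun k l => extend_of_mem (fun g : weylD n => F (fw g)) (swpBar_mem_weylD k l)
  simp only [bracketD, cross, pos, neg]
  split_ifs with hji
  · rw [zero_smul, sub_zero, map_neg, map_smul, map_sum]
    congr 2
    refine Finset.sum_congr rfl fun k hk => ?_
    rw [h1, h2]
    simp
  · rw [swp_comm j i, swpBar_comm j i, h1, h2]
    simp


theorem map_bracketB (u v : ℂ)
    (F : FreeAlgebra ℂ (Gen (weylB n)) →ₐ[ℂ] R) (j i : Fin n) :
    F (bracketB n u v j i) =
      cross u (((Real.sqrt 2 : ℝ) : ℂ) * v) (fun k => F (fc k)) (extend fun g => F (fw g)) j i := by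
  have h0 := fun g : SignedPerm n => extend_of_mem (fun g : weylB n => F (fw g))
    (Subgroup.mem_top g)
  simp only [bracketB, cross, pos, neg]
  split_ifs with hji
  · rw [map_sub, map_neg, map_smul, map_sum, map_smul, h0]
    congr 3
    refine Finset.sum_congr rfl fun k hk => ?_
    rw [h0, h0]
    simp only [map_add, map_sub, map_mul, map_one]
  · rw [swp_comm j i, swpBar_comm j i, h0, h0]
    simp only [map_smul, map_add, map_sub, map_mul, map_one]


/-- Stated for any homomorphism out of the free algebra, so that it serves both the quotient map to
`H n T` and the representation on the induced module. -/
theorem map_bracket (T : Datum) (F : FreeAlgebra ℂ (Gen (T.W n)) →ₐ[ℂ] R) (j i : Fin n) :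
    F (bracket n T j i) =
      cross T.u T.v (fun k => F (fc k)) (extend fun g => F (fw g)) j i :=
  match T, F with
  | .A u, F => map_bracketA u F j i
  | .D u, F => map_bracketD u F j i
  | .B u v, F => map_bracketB u v F j i

end

end Bracket

/-! ### Generators and relations -/

section Generators

variable (n : ℕ) (T : Datum)

/-- The generator `x_i`. -/
def hx (i : Fin n) : H n T := gen n T (.x i)
/-- The generator `y_i`. -/
def hy (i : Fin n) : H n T := gen n T (.y i)
/-- The generator `c_i`. -/
def hc (i : Fin n) : H n T := gen n T (.c i)
/-- The group elements, extended by zero to all signed permutations. -/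
def hw (g : SignedPerm n) : H n T := extend (fun g : T.W n => gen n T (.w g)) g

variable {n T}

theorem hw_of_mem {g : SignedPerm n} (h : g ∈ T.W n) : hw n T g = gen n T (.w ⟨g, h⟩) :=
  extend_of_mem _ h

theorem hw_of_notMem {g : SignedPerm n} (h : g ∉ T.W n) : hw n T g = 0 := extend_of_notMem _ h

theorem mk_rel {a b : FreeAlgebra ℂ (Gen (T.W n))} (h : Rel n T a b) :
    RingQuot.mkAlgHom ℂ (Rel n T) a = RingQuot.mkAlgHom ℂ (Rel n T) b :=
  RingQuot.mkAlgHom_rel ℂ h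

theorem hw_one : hw n T 1 = 1 := by
  rw [hw_of_mem (one_mem _)]
  exact (mk_rel Rel.w_one).trans (map_one _)

theorem hw_mul {g h : SignedPerm n} (hg : g ∈ T.W n) (hh : h ∈ T.W n) :
    hw n T g * hw n T h = hw n T (g * h) := by
  rw [hw_of_mem hg, hw_of_mem hh, hw_of_mem (mul_mem hg hh)]
  simpa [gen, hx, hy, hc] using mk_rel (Rel.w_mul (n := n) (T := T) ⟨g, hg⟩ ⟨h, hh⟩)

theorem eq_of_conj {g : SignedPerm n} (hg : g ∈ T.W n) {a b : H n T}
    (h : hw n T g * a * hw n T g⁻¹ = b) : hw n T g * a = b * hw n T g := by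
  rw [← h, mul_assoc, hw_mul (inv_mem hg) hg, inv_mul_cancel, hw_one, mul_one]

theorem hw_x (g : SignedPerm n) (i : Fin n) :
    hw n T g * hx n T i = coeff g i • (hx n T (g.right i) * hw n T g) := by
  by_cases hg : g ∈ T.W n
  · rw [← smul_mul_assoc]
    apply eq_of_conj hg
    rw [hw_of_mem hg, hw_of_mem (inv_mem hg)]
    have := mk_rel (Rel.w_x (n := n) (T := T) ⟨g, hg⟩ i)
    rwa [map_mul, map_mul, map_smul] at this
  · simp [hw_of_notMem hg]

theorem hw_y (g : SignedPerm n) (i : Fin n) :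
    hw n T g * hy n T i = coeff g i • (hy n T (g.right i) * hw n T g) := by
  by_cases hg : g ∈ T.W n
  · rw [← smul_mul_assoc]
    apply eq_of_conj hg
    rw [hw_of_mem hg, hw_of_mem (inv_mem hg)]
    have := mk_rel (Rel.w_y (n := n) (T := T) ⟨g, hg⟩ i)
    rwa [map_mul, map_mul, map_smul] at this
  · simp [hw_of_notMem hg]

theorem hw_c (g : SignedPerm n) (i : Fin n) :
    hw n T g * hc n T i = coeff g i • (hc n T (g.right i) * hw n T g) := by
  by_cases hg : g ∈ T.W n
  · rw [← smul_mul_assoc]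
    apply eq_of_conj hg
    rw [hw_of_mem hg, hw_of_mem (inv_mem hg)]
    have := mk_rel (Rel.w_c (n := n) (T := T) ⟨g, hg⟩ i)
    rwa [map_mul, map_mul, map_smul] at this
  · simp [hw_of_notMem hg]

theorem hy_hc (i j : Fin n) : hy n T i * hc n T j = hc n T j * hy n T i := by
  simpa [gen, hx, hy, hc] using mk_rel (Rel.y_c (n := n) (T := T) i j)

variable (n T) in
theorem cliffordData : CliffordData (T.W n) (hc n T) (hw n T) where
  c_sq i := by simpa [gen, hx, hy, hc] using mk_rel (Rel.c_sq (n := n) (T := T) i)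
  c_anti i j hij := by simpa [gen, hx, hy, hc] using mk_rel (Rel.c_anti (n := n) (T := T) i j hij)
  s_c := hw_c
  s_one := hw_one
  mul_left g hg h := by
    by_cases hh : h ∈ T.W n
    · exact hw_mul hg hh
    · rw [hw_of_notMem hh, hw_of_notMem (mt (Subgroup.mul_mem_cancel_left _ hg).1 hh), mul_zero]
  mul_right g hg h := by
    by_cases hh : h ∈ T.W n
    · exact hw_mul hh hg
    · rw [hw_of_notMem hh, hw_of_notMem (mt (Subgroup.mul_mem_cancel_right _ hg).1 hh), zero_mul]

variable (n T) in
theorem positionData : PositionData (hc n T) (hw n T) (hx n T) :=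
  .of_relations (fun i => by simpa [gen, hx, hc] using mk_rel (Rel.x_c_same (n := n) (T := T) i))
    (fun i l h => by simpa [gen, hx, hc] using mk_rel (Rel.x_c (n := n) (T := T) i l h)) hw_x

theorem hy_hx (j i : Fin n) :
    hy n T j * hx n T i - hx n T i * hy n T j = cross T.u T.v (hc n T) (hw n T) j i := by
  have := mk_rel (Rel.y_x (n := n) (T := T) j i)
  rw [map_bracket] at this
  rwa [map_sub, map_mul, map_mul] at this

end Generators

/-! ### A faithful module -/

section Clifford

variable {n : ℕ}

/-- The sum of the squares of the coordinates. -/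
def sumSq (n : ℕ) : QuadraticForm ℂ (Fin n → ℂ) :=
  QuadraticMap.weightedSumSquares ℂ fun _ => (1 : ℂ)

theorem sumSq_apply (v : Fin n → ℂ) : sumSq n v = ∑ i, v i * v i := by
  simp [sumSq, QuadraticMap.weightedSumSquares_apply]

/-- The action of signed permutations on vectors. -/
def vecAct (g : SignedPerm n) : sumSq n →qᵢ sumSq n where
  toFun v j := (((g.left j : ℤˣ) : ℤ) : ℂ) * v (g.right⁻¹ j)
  map_add' v w := by ext j; simp [mul_add]
  map_smul' r v := by ext j; simp [mul_left_comm]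
  map_app' v := by
    simp only [sumSq_apply]
    rw [← Equiv.sum_comp g.right]
    refine Finset.sum_congr rfl fun i _ => ?_
    have := coeff_sq g i
    rw [coeff] at this
    simp only [Equiv.Perm.inv_def, Equiv.symm_apply_apply]
    linear_combination (v i * v i) * this

theorem vecAct_single (g : SignedPerm n) (i : Fin n) :
    vecAct g (Pi.single i 1) = coeff g i • Pi.single (g.right i) 1 := by
  ext j
  change (((g.left j : ℤˣ) : ℤ) : ℂ) * (Pi.single i 1 : Fin n → ℂ) (g.right⁻¹ j) = _
  rcases eq_or_ne j (g.right i) with rfl | h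
  · simp [coeff]
  · have : g.right⁻¹ j ≠ i := by rintro rfl; simp at h
    rw [Pi.single_eq_of_ne this]
    simp [h]

/-- The Clifford algebra of the sum of squares. -/
abbrev Cl (n : ℕ) : Type := CliffordAlgebra (sumSq n)

/-- The generators of the Clifford algebra. -/
def clGen (i : Fin n) : Cl n := CliffordAlgebra.ι (sumSq n) (Pi.single i 1)

/-- The action of signed permutations on the Clifford algebra. -/
def clAct (g : SignedPerm n) : Cl n →ₐ[ℂ] Cl n := CliffordAlgebra.map (vecAct g)

theorem clAct_gen (g : SignedPerm n) (i : Fin n) :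
    clAct g (clGen i) = coeff g i • clGen (g.right i) := by
  rw [clAct, clGen, CliffordAlgebra.map_apply_ι, vecAct_single, map_smul, clGen]

theorem cl_hom_ext {A : Type*} [Semiring A] [Algebra ℂ A] {f f' : Cl n →ₐ[ℂ] A}
    (h : ∀ i, f (clGen i) = f' (clGen i)) : f = f' := by
  refine CliffordAlgebra.hom_ext ((Pi.basisFun ℂ (Fin n)).ext fun i => ?_)
  rw [Pi.basisFun_apply]
  exact h i

theorem clAct_mul (g h : SignedPerm n) : clAct (g * h) = (clAct g).comp (clAct h) :=
  cl_hom_ext fun i => by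
    simp [clAct_gen, coeff_mul, smul_smul, mul_comm]

theorem clAct_one : clAct (1 : SignedPerm n) = AlgHom.id ℂ _ :=
  cl_hom_ext fun i => by simp [clAct_gen, coeff_one]

theorem clGen_sq (i : Fin n) : clGen i * clGen i = 1 := by
  rw [clGen, CliffordAlgebra.ι_sq_scalar, sumSq_apply, Finset.sum_eq_single i] <;>
    simp +contextual

theorem clGen_anti {i j : Fin n} (h : i ≠ j) : clGen i * clGen j = -(clGen j * clGen i) := by
  refine CliffordAlgebra.ι_mul_ι_comm_of_isOrtho ?_
  simp only [QuadraticMap.isOrtho_def, sumSq_apply, ← Finset.sum_add_distrib]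
  refine Finset.sum_congr rfl fun k _ => ?_
  rcases eq_or_ne k i with rfl | h1
  · simp [h]
  · simp [h1]

instance : Nontrivial (Cl n) :=
  letI : Invertible (2 : ℂ) := invertibleOfNonzero two_ne_zero
  inferInstance

/-- The module of polynomials in the `x_i` with coefficients in the Clifford algebra. -/
abbrev Base (n : ℕ) : Type := Ind n (Cl n)

/-- The action of `x_i` on the base module. -/
def baseX (i : Fin n) : Module.End ℂ (Base n) := tens (LinearMap.mulLeft ℂ (X i)) 1

/-- The sign change of the `j`-th variable. -/
def flip (j : Fin n) : MvPolynomial (Fin n) ℂ →ₐ[ℂ] MvPolynomial (Fin n) ℂ := polyAct (tau j)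

/-- The action of `c_i` on the base module. -/
def baseC (i : Fin n) : Module.End ℂ (Base n) :=
  tens (flip i).toLinearMap (LinearMap.mulLeft ℂ (clGen i))

/-- The action of `W` on the base module. -/
def baseS (W : Subgroup (SignedPerm n)) (g : SignedPerm n) : Module.End ℂ (Base n) :=
  extend (fun g : W => tens (polyAct g.1).toLinearMap (clAct g.1).toLinearMap) g

theorem tau_mul_tau_comm (i j : Fin n) : tau i * tau j = tau j * tau i := by
  rw [mul_tau]; rfl

theorem tau_mul_self (i : Fin n) : tau i * tau i = 1 := by
  apply signedPerm_ext <;> intro k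
  · by_cases h : k = i <;> simp [coeff_mul, coeff_tau, tau_right, coeff_one, h]
  · rfl

variable (W : Subgroup (SignedPerm n))

theorem baseS_of_mem {g : SignedPerm n} (h : g ∈ W) :
    baseS W g = tens (polyAct g).toLinearMap (clAct g).toLinearMap := extend_of_mem _ h

theorem baseS_of_notMem {g : SignedPerm n} (h : g ∉ W) : baseS W g = 0 := extend_of_notMem _ h

theorem baseS_mul {g h : SignedPerm n} (hg : g ∈ W) (hh : h ∈ W) :
    baseS W g * baseS W h = baseS W (g * h) := by
  rw [baseS_of_mem W hg, baseS_of_mem W hh, baseS_of_mem W (mul_mem hg hh), tens_mul, polyAct_mul,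
    clAct_mul]
  rfl

/-- The sign change of the variable built into `baseC` makes `c_i` anticommute with `x_i`. It does
not disturb the Clifford relations, because sign changes commute with each other and square to one.
-/
theorem base_cliffordData : CliffordData W (baseC (n := n)) (baseS W) where
  c_sq i := end_ext fun p m => by
    rw [baseC, Module.End.mul_apply, tens_tm, tens_tm]
    simp only [flip, AlgHom.toLinearMap_apply, LinearMap.mulLeft_apply, Module.End.one_apply]
    rw [← AlgHom.comp_apply, ← polyAct_mul, tau_mul_self, polyAct_one, ← mul_assoc, clGen_sq,
      one_mul, AlgHom.id_apply]
  c_anti i j hij := end_ext fun p m => by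
    rw [LinearMap.neg_apply, Module.End.mul_apply, Module.End.mul_apply]
    simp only [baseC, tens_tm, flip, AlgHom.toLinearMap_apply, LinearMap.mulLeft_apply]
    rw [← AlgHom.comp_apply, ← AlgHom.comp_apply, ← polyAct_mul, ← polyAct_mul,
      tau_mul_tau_comm, ← mul_assoc, clGen_anti hij, neg_mul, map_neg, mul_assoc]
  s_c g i := by
    by_cases hg : g ∈ W
    · rw [baseS_of_mem W hg]
      refine end_ext fun p m => ?_
      rw [LinearMap.smul_apply, Module.End.mul_apply, Module.End.mul_apply]
      simp only [baseC, tens_tm, flip, AlgHom.toLinearMap_apply, LinearMap.mulLeft_apply]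
      rw [← AlgHom.comp_apply, ← AlgHom.comp_apply, ← polyAct_mul, ← polyAct_mul,
        mul_tau, map_mul, clAct_gen, smul_mul_assoc, map_smul]
    · rw [baseS_of_notMem W hg, zero_mul, mul_zero, smul_zero]
  s_one := by
    rw [baseS_of_mem W (one_mem W), polyAct_one, clAct_one]
    exact tens_one
  mul_left g hg h := by
    by_cases hh : h ∈ W
    · exact baseS_mul W hg hh
    · rw [baseS_of_notMem W hh, baseS_of_notMem W (mt (Subgroup.mul_mem_cancel_left _ hg).1 hh),
        mul_zero]
  mul_right g hg h := by
    by_cases hh : h ∈ W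
    · exact baseS_mul W hh hg
    · rw [baseS_of_notMem W hh, baseS_of_notMem W (mt (Subgroup.mul_mem_cancel_right _ hg).1 hh),
        zero_mul]

theorem base_positionData : PositionData (baseC (n := n)) (baseS W) baseX where
  x_c i l := end_ext fun p m => by
    rw [LinearMap.smul_apply, Module.End.mul_apply, Module.End.mul_apply]
    simp only [baseC, baseX, tens_tm, flip, AlgHom.toLinearMap_apply, LinearMap.mulLeft_apply,
      Module.End.one_apply, map_mul, polyAct_X, coeff_tau, tau_right, Equiv.Perm.coe_one, id,
      smul_mul_assoc, map_smul, LinearMap.smul_apply, smul_smul, sgn]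
    by_cases h : i = l <;> simp [h]
  s_x g i := by
    by_cases hg : g ∈ W
    · rw [baseS_of_mem W hg]
      refine end_ext fun p m => ?_
      rw [LinearMap.smul_apply, Module.End.mul_apply, Module.End.mul_apply]
      simp only [baseX, tens_tm, AlgHom.toLinearMap_apply, LinearMap.mulLeft_apply,
        Module.End.one_apply, map_mul, polyAct_X, smul_mul_assoc, map_smul, LinearMap.smul_apply]
    · rw [baseS_of_notMem W hg, zero_mul, mul_zero, smul_zero]

theorem baseX_comm (i j : Fin n) : (baseX i * baseX j : Module.End ℂ (Base n)) =
    baseX j * baseX i :=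
  end_ext fun p m => by
    simp only [Module.End.mul_apply, baseX, tens_tm, LinearMap.mulLeft_apply, mul_left_comm]

end Clifford

/-! ### The representation on the induced module and injectivity on polynomials -/

section Faithful

variable (n : ℕ) (T : Datum)

/-- The images of the generators in the endomorphisms of the faithful module. -/
def genEnd : Gen (T.W n) → Module.End ℂ (Ind n (Base n))
  | .x i => opX T.u T.v baseC (baseS (T.W n)) baseX i
  | .y i => opY i
  | .c i => opC baseC i
  | .w g => opS (baseS (T.W n)) g.1

theorem lift_genEnd_bracket (j i : Fin n) :
    FreeAlgebra.lift ℂ (genEnd n T) (bracket n T j i) =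
      cross T.u T.v (opC baseC) (opS (baseS (T.W n))) j i := by
  rw [map_bracket]
  congr 1
  · ext1 k
    rw [FreeAlgebra.lift_ι_apply, genEnd]
  · ext1 g
    by_cases hg : g ∈ T.W n
    · rw [extend_of_mem _ hg, FreeAlgebra.lift_ι_apply, genEnd]
    · rw [extend_of_notMem _ hg, opS, baseS_of_notMem _ hg, tens_zero]

theorem lift_genEnd_rel {a b : FreeAlgebra ℂ (Gen (T.W n))} (h : Rel n T a b) :
    FreeAlgebra.lift ℂ (genEnd n T) a = FreeAlgebra.lift ℂ (genEnd n T) b := by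
  have hC := base_cliffordData (T.W n)
  have hC' := opC_data hC
  have hX := opX_data hC (base_positionData (T.W n)) (fun g => baseS_of_notMem _) T.u T.v
  -- The defining relations have the form `w ξ w⁻¹ = w(ξ)`, whereas the operator identities have the
  -- form `w ξ = w(ξ) w`.
  have conj : ∀ (g : T.W n) {a b : Module.End ℂ (Ind n (Base n))},
      opS (baseS (T.W n)) g.1 * a = b * opS (baseS (T.W n)) g.1 →
      opS (baseS (T.W n)) g.1 * a * opS (baseS (T.W n)) (g.1)⁻¹ = b := by
    intro g a b e
    rw [e, mul_assoc, hC'.mul_left g g.2, mul_inv_cancel, hC'.s_one, mul_one]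
  cases h with
  | y_x j i =>
    rw [lift_genEnd_bracket, ← cross_eq (x := baseX)]
    simp [genEnd]
  | w_one => simpa [genEnd] using hC'.s_one
  | w_mul g h => simpa [genEnd] using hC'.mul_left g g.2 h
  | c_sq i => simpa [genEnd] using hC'.c_sq i
  | c_anti i j hij => simpa [genEnd] using hC'.c_anti i j hij
  | x_comm i j =>
    simpa [genEnd] using opX_comm hC (base_positionData (T.W n)) (fun g => baseS_of_notMem _)
      baseX_comm T.u T.v i j
  | y_comm i j => simpa [genEnd] using opY_comm i j
  | y_c i j => simpa [genEnd] using opY_opC i j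
  | x_c_same i => simpa [genEnd, sgn] using hX.x_c i i
  | x_c i j hij => simpa [genEnd, sgn, hij] using hX.x_c i j
  | w_x g i =>
    have := conj g ((hX.s_x g i).trans (smul_mul_assoc _ _ _).symm)
    simpa [genEnd] using this
  | w_y g i =>
    have := conj g ((opS_opY (s := baseS (T.W n)) g.1 i).trans (smul_mul_assoc _ _ _).symm)
    simpa [genEnd] using this
  | w_c g i =>
    have := conj g ((hC'.s_c g i).trans (smul_mul_assoc _ _ _).symm)
    simpa [genEnd] using this

/-- The action of the algebra on the module induced from the base module. -/
def toEnd : H n T →ₐ[ℂ] Module.End ℂ (Ind n (Base n)) :=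
  RingQuot.liftAlgHom ℂ ⟨FreeAlgebra.lift ℂ (genEnd n T), fun _ _ h => lift_genEnd_rel n T h⟩

theorem toEnd_gen (a : Gen (T.W n)) : toEnd n T (gen n T a) = genEnd n T a := by
  rw [toEnd, gen, RingQuot.liftAlgHom_mkAlgHom_apply, FreeAlgebra.lift_ι_apply]

theorem polyX_X (i : Fin n) : polyX n T (X i) = hx n T i := polyEval_X _ _ i

theorem polyY_X (i : Fin n) : polyY n T (X i) = hy n T i := polyEval_X _ _ i

theorem toEnd_polyX (f : MvPolynomial (Fin n) ℂ) :
    toEnd n T (polyX n T f) (tm 1 (tm 1 1)) = tm 1 (tm f 1) := by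
  induction f using MvPolynomial.induction_on with
  | C r => rw [← mul_one (C r), ← smul_eq_C_mul]; simp
  | add p q hp hq => simp [hp, hq]
  | mul_X p i hp =>
    rw [mul_comm, map_mul, map_mul, Module.End.mul_apply, hp, polyX_X, hx, toEnd_gen, genEnd,
      opX_vacuum, baseX, tens_tm, LinearMap.mulLeft_apply, Module.End.one_apply]

theorem toEnd_polyY (f : MvPolynomial (Fin n) ℂ) :
    toEnd n T (polyY n T f) (tm 1 (tm 1 1)) = tm f (tm 1 1) := by
  induction f using MvPolynomial.induction_on with
  | C r => rw [← mul_one (C r), ← smul_eq_C_mul]; simp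
  | add p q hp hq => simp [hp, hq]
  | mul_X p i hp =>
    rw [mul_comm, map_mul, map_mul, Module.End.mul_apply, hp, polyY_X, hy, toEnd_gen, genEnd,
      opY, tens_tm, LinearMap.mulLeft_apply, Module.End.one_apply]

/-- Applying a linear functional `φ` to the second factor gives `φ m • p = 0`, and functionals
separate the points of `M`. -/
theorem tm_eq_zero {n : ℕ} {M : Type*} [AddCommGroup M] [Module ℂ M]
    {p : MvPolynomial (Fin n) ℂ} {m : M} (h : tm p m = 0) : p = 0 ∨ m = 0 := by
  rw [or_iff_not_imp_left]
  intro hp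
  refine (Module.forall_dual_apply_eq_zero_iff ℂ m).1 fun φ => ?_
  let L : Ind n M →ₗ[ℂ] MvPolynomial (Fin n) ℂ :=
    TensorProduct.lift ((LinearMap.lsmul ℂ _).comp φ).flip
  have : L (tm p m) = 0 := by rw [h, map_zero]
  exact (smul_eq_zero.1 (this : φ m • p = 0)).resolve_right hp

theorem tm_one_one_ne_zero : (tm 1 1 : Base n) ≠ 0 := fun h =>
  (tm_eq_zero h).elim one_ne_zero one_ne_zero

theorem polyX_injective : Function.Injective (polyX n T) := by
  rw [injective_iff_map_eq_zero]
  intro f hf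
  have h := toEnd_polyX n T f
  rw [hf, map_zero, LinearMap.zero_apply] at h
  rcases tm_eq_zero h.symm with h | h
  · exact (one_ne_zero h).elim
  · exact (tm_eq_zero h).resolve_right one_ne_zero

theorem polyY_injective : Function.Injective (polyY n T) := by
  rw [injective_iff_map_eq_zero]
  intro f hf
  have h := toEnd_polyY n T f
  rw [hf, map_zero, LinearMap.zero_apply] at h
  exact (tm_eq_zero h.symm).resolve_right (tm_one_one_ne_zero n)

end Faithful

/-! ### Twisted derivations -/

section Derivation

variable {n : ℕ} {R : Type*} [Ring R] [Algebra ℂ R]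

/-- Derivations from polynomials to the bimodule `R` over them. -/
def IsDer (φ : MvPolynomial (Fin n) ℂ →ₐ[ℂ] R) (D : MvPolynomial (Fin n) ℂ →ₗ[ℂ] R) : Prop :=
  ∀ f g, D (f * g) = D f * φ g + φ f * D g

variable {φ : MvPolynomial (Fin n) ℂ →ₐ[ℂ] R} {D D' : MvPolynomial (Fin n) ℂ →ₗ[ℂ] R}

theorem IsDer.add (h : IsDer φ D) (h' : IsDer φ D') : IsDer φ (D + D') := fun f g => by
  simp only [LinearMap.add_apply, h f g, h' f g, add_mul, mul_add]
  abel

theorem IsDer.smul (r : ℂ) (h : IsDer φ D) : IsDer φ (r • D) := fun f g => by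
  simp only [LinearMap.smul_apply, h f g, smul_add, smul_mul_assoc, mul_smul_comm]

theorem IsDer.sum {ι : Type*} (t : Finset ι) {E : ι → MvPolynomial (Fin n) ℂ →ₗ[ℂ] R}
    (h : ∀ k ∈ t, IsDer φ (E k)) : IsDer φ (∑ k ∈ t, E k) := fun f g => by
  simp only [LinearMap.sum_apply, Finset.sum_mul, Finset.mul_sum, ← Finset.sum_add_distrib]
  exact Finset.sum_congr rfl fun k hk => h k hk f g

theorem IsDer.ext (h : IsDer φ D) (h' : IsDer φ D') (hX : ∀ i, D (X i) = D' (X i)) : D = D' := by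
  have one : ∀ {D}, IsDer φ D → D 1 = 0 := fun {D} h => by
    have := h 1 1
    simpa using this
  refine LinearMap.ext fun f => ?_
  induction f using MvPolynomial.induction_on with
  | C r => rw [← mul_one (C r), ← smul_eq_C_mul, map_smul, map_smul, one h, one h']
  | add p q hp hq => rw [map_add, map_add, hp, hq]
  | mul_X p i hp => rw [h, h', hp, hX]

/-- The commutator with a fixed element, restricted to polynomials. -/
def commDer (φ : MvPolynomial (Fin n) ℂ →ₐ[ℂ] R) (ξ : R) : MvPolynomial (Fin n) ℂ →ₗ[ℂ] R :=
  (LinearMap.mulLeft ℂ ξ - LinearMap.mulRight ℂ ξ).comp φ.toLinearMap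

theorem commDer_apply (ξ : R) (f : MvPolynomial (Fin n) ℂ) :
    commDer φ ξ f = ξ * φ f - φ f * ξ := rfl

theorem commutator_sq {A : Type*} [Ring A] (ξ a : A) :
    ξ * (a * a) - a * a * ξ = (ξ * a - a * ξ) * a + a * (ξ * a - a * ξ) := by
  noncomm_ring

theorem isDer_commDer (ξ : R) : IsDer φ (commDer φ ξ) := fun f g => by
  simp only [commDer_apply, map_mul]
  noncomm_ring

/-- A divided difference followed by multiplication with a fixed element. -/
def diffDer (φ : MvPolynomial (Fin n) ℂ →ₐ[ℂ] R)
    (Δ : MvPolynomial (Fin n) ℂ →ₗ[ℂ] MvPolynomial (Fin n) ℂ) (e : R) :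
    MvPolynomial (Fin n) ℂ →ₗ[ℂ] R :=
  (LinearMap.mulRight ℂ e).comp (φ.toLinearMap.comp Δ)

theorem diffDer_apply (Δ : MvPolynomial (Fin n) ℂ →ₗ[ℂ] MvPolynomial (Fin n) ℂ) (e : R)
    (f : MvPolynomial (Fin n) ℂ) : diffDer φ Δ e f = φ (Δ f) * e := rfl

theorem mul_map_eq_of_X {σ : MvPolynomial (Fin n) ℂ →ₐ[ℂ] MvPolynomial (Fin n) ℂ} {e : R}
    (he : ∀ i, e * φ (X i) = φ (σ (X i)) * e) (f : MvPolynomial (Fin n) ℂ) :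
    e * φ f = φ (σ f) * e := by
  induction f using MvPolynomial.induction_on with
  | C r =>
    rw [← MvPolynomial.algebraMap_eq, AlgHom.commutes, AlgHom.commutes, AlgHom.commutes,
      Algebra.commutes]
  | add p q hp hq => rw [map_add, map_add, map_add, mul_add, add_mul, hp, hq]
  | mul_X p i hp =>
    rw [map_mul, map_mul, map_mul, ← mul_assoc, hp, mul_assoc, he, mul_assoc]

/-- Right multiplication by an element that implements `σ` turns the twisted Leibniz rule into the
ordinary one. -/
theorem isDer_diffDer {σ : MvPolynomial (Fin n) ℂ →ₐ[ℂ] MvPolynomial (Fin n) ℂ}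
    {a : MvPolynomial (Fin n) ℂ} {e : R} (he : ∀ i, e * φ (X i) = φ (σ (X i)) * e) :
    IsDer φ (diffDer φ (divDiff σ a) e) := fun f g => by
  rw [diffDer_apply, diffDer_apply, diffDer_apply, divDiff_mul, map_add, map_mul, map_mul, add_mul,
    mul_assoc, ← mul_map_eq_of_X he, mul_assoc, mul_assoc]

end Derivation

/-! ### Centrality -/

section Center

variable {n : ℕ} {T : Datum}

theorem adjoin_gen : Algebra.adjoin ℂ (Set.range (gen n T)) = ⊤ := by
  have h : Set.range (gen n T) =
      RingQuot.mkAlgHom ℂ (Rel n T) '' Set.range (FreeAlgebra.ι ℂ) := by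
    rw [← Set.range_comp]; rfl
  rw [h, Algebra.adjoin_image, FreeAlgebra.adjoin_range_ι, Algebra.map_top,
    AlgHom.range_eq_top]
  exact RingQuot.mkAlgHom_surjective ℂ _

theorem eq_top_of_gen_mem {S : Subalgebra ℂ (H n T)} (hx' : ∀ i, hx n T i ∈ S)
    (hy' : ∀ i, hy n T i ∈ S) (hc' : ∀ i, hc n T i ∈ S) (hw' : ∀ g ∈ T.W n, hw n T g ∈ S) :
    S = ⊤ := by
  rw [eq_top_iff, ← adjoin_gen, Algebra.adjoin_le_iff]
  rintro _ ⟨a, rfl⟩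
  cases a with
  | x i => exact hx' i
  | y i => exact hy' i
  | c i => exact hc' i
  | w g =>
    have := hw' g g.2
    rwa [hw_of_mem g.2] at this

theorem mem_center_of_gen {a : H n T} (hx' : ∀ i, hx n T i * a = a * hx n T i)
    (hy' : ∀ i, hy n T i * a = a * hy n T i) (hc' : ∀ i, hc n T i * a = a * hc n T i)
    (hw' : ∀ g ∈ T.W n, hw n T g * a = a * hw n T g) :
    a ∈ Subalgebra.center ℂ (H n T) := by
  have h : Subalgebra.centralizer ℂ {a} = (⊤ : Subalgebra ℂ (H n T)) :=
    eq_top_of_gen_mem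
      (fun i => by rw [Subalgebra.mem_centralizer_iff]; rintro _ rfl; exact (hx' i).symm)
      (fun i => by rw [Subalgebra.mem_centralizer_iff]; rintro _ rfl; exact (hy' i).symm)
      (fun i => by rw [Subalgebra.mem_centralizer_iff]; rintro _ rfl; exact (hc' i).symm)
      (fun i hi => by rw [Subalgebra.mem_centralizer_iff]; rintro _ rfl; exact (hw' i hi).symm)
  rw [Subalgebra.mem_center_iff]
  intro b
  have hb : b ∈ Subalgebra.centralizer ℂ {a} := h ▸ Algebra.mem_top
  exact ((Subalgebra.mem_centralizer_iff ℂ).1 hb a rfl).symm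

theorem gen_mem_evenPart {a : Gen (T.W n)} (h : degree a = 0) : gen n T a ∈ evenPart n T :=
  Submodule.subset_span ⟨[a], by simpa using h, by simp⟩

theorem map_mem_of_X {R : Type*} [Ring R] [Algebra ℂ R] {φ : MvPolynomial (Fin n) ℂ →ₐ[ℂ] R}
    {S : Subalgebra ℂ R} (h : ∀ i, φ (X i) ∈ S) (f : MvPolynomial (Fin n) ℂ) : φ f ∈ S := by
  have : S.comap φ = ⊤ := by
    rw [eq_top_iff, ← MvPolynomial.adjoin_range_X, Algebra.adjoin_le_iff]
    rintro _ ⟨i, rfl⟩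
    exact h i
  have hf : f ∈ S.comap φ := this ▸ Algebra.mem_top
  exact hf

theorem polyX_mem_evenPart (f : MvPolynomial (Fin n) ℂ) : polyX n T f ∈ evenPart n T :=
  map_mem_of_X (fun i => by rw [polyX_X]; exact gen_mem_evenPart rfl) f

theorem polyY_mem_evenPart (f : MvPolynomial (Fin n) ℂ) : polyY n T f ∈ evenPart n T :=
  map_mem_of_X (fun i => by rw [polyY_X]; exact gen_mem_evenPart rfl) f

theorem hw_polyX (g : SignedPerm n) (f : MvPolynomial (Fin n) ℂ) :
    hw n T g * polyX n T f = polyX n T (polyAct g f) * hw n T g :=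
  mul_map_eq_of_X (fun i => by
    rw [polyAct_X, map_smul, polyX_X, polyX_X, hw_x, smul_mul_assoc]) f

theorem hw_polyY (g : SignedPerm n) (f : MvPolynomial (Fin n) ℂ) :
    hw n T g * polyY n T f = polyY n T (polyAct g f) * hw n T g :=
  mul_map_eq_of_X (fun i => by
    rw [polyAct_X, map_smul, polyY_X, polyY_X, hw_y, smul_mul_assoc]) f

theorem hc_polyY (i : Fin n) (f : MvPolynomial (Fin n) ℂ) :
    hc n T i * polyY n T f = polyY n T f * hc n T i :=
  mul_map_eq_of_X (σ := AlgHom.id ℂ _) (fun j => by rw [AlgHom.id_apply, polyY_X, hy_hc]) f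

theorem hc_polyX (i : Fin n) (f : MvPolynomial (Fin n) ℂ) :
    hc n T i * polyX n T f = polyX n T (flip i f) * hc n T i :=
  mul_map_eq_of_X (fun j => by
    rw [flip, polyAct_X, map_smul, tau_right, coeff_tau, Equiv.Perm.coe_one, id, polyX_X,
      smul_mul_assoc, (positionData n T).x_c, smul_smul, sgn]
    split_ifs <;> simp) f

theorem hc_hc_polyY (i j : Fin n) (f : MvPolynomial (Fin n) ℂ) :
    hc n T i * hc n T j * polyY n T f = polyY n T f * (hc n T i * hc n T j) := by
  rw [mul_assoc, hc_polyY, ← mul_assoc, hc_polyY, mul_assoc]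

theorem pos_polyY (k i : Fin n) (f : MvPolynomial (Fin n) ℂ) :
    pos (hc n T) (hw n T) k i * polyY n T f =
      polyY n T (polyAct (swp k i) f) * pos (hc n T) (hw n T) k i := by
  rw [pos, mul_assoc, hw_polyY, ← mul_assoc, ← mul_assoc, add_mul, mul_add, hc_hc_polyY, one_mul,
    mul_one]

theorem neg_polyY (k i : Fin n) (f : MvPolynomial (Fin n) ℂ) :
    neg (hc n T) (hw n T) k i * polyY n T f =
      polyY n T (polyAct (swpBar k i) f) * neg (hc n T) (hw n T) k i := by
  rw [neg, mul_assoc, hw_polyY, ← mul_assoc, ← mul_assoc, sub_mul, mul_sub, hc_hc_polyY, one_mul,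
    mul_one]

theorem swp_mem_W (i j : Fin n) : swp i j ∈ T.W n := by
  cases T
  · exact swp_mem_weylA i j
  · exact swp_mem_weylD i j
  · exact Subgroup.mem_top _

/-- The commutator of `x_i` with polynomials in the `y_j`. -/
theorem commDer_polyY (i : Fin n) :
    commDer (polyY n T) (hx n T i) = T.u • ∑ k ∈ Finset.univ.erase i,
      (diffDer (polyY n T) (diffPos i k) (pos (hc n T) (hw n T) k i) +
        diffDer (polyY n T) (diffNeg i k) (neg (hc n T) (hw n T) k i)) +
      T.v • diffDer (polyY n T) (diffTau i) (hw n T (tau i)) := by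
  refine (isDer_commDer _).ext ?_ fun l => ?_
  · refine (IsDer.smul _ (IsDer.sum _ fun k _ => ?_)).add (IsDer.smul _ ?_)
    · exact (isDer_diffDer fun l => pos_polyY k i _).add (isDer_diffDer fun l => neg_polyY k i _)
    · exact isDer_diffDer fun l => hw_polyY _ _
  -- On a variable both sides are known, and `cross_eq_sum` displays the same values of the divided
  -- differences.
  · rw [commDer_apply, polyY_X, ← neg_sub, hy_hx, cross_eq_sum, neg_neg]
    simp only [LinearMap.add_apply, LinearMap.smul_apply, LinearMap.sum_apply, diffDer_apply]
    congr 2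
    · refine Finset.sum_congr rfl fun k hk => ?_
      have hk := Finset.ne_of_mem_erase hk
      rw [diffPos_X hk, diffNeg_X hk, ← MvPolynomial.algebraMap_eq, AlgHom.commutes,
        AlgHom.commutes, ← Algebra.smul_def, ← Algebra.smul_def]
    · rw [diffTau_X, ← MvPolynomial.algebraMap_eq, AlgHom.commutes, ← Algebra.smul_def]

/-- Either the reflection lies in `W` and the divided difference vanishes on `f`, or it does not and
its coefficient is zero. -/
theorem diffDer_eq_zero {φ : MvPolynomial (Fin n) ℂ →ₐ[ℂ] H n T} {f a : MvPolynomial (Fin n) ℂ}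
    {g : SignedPerm n} (hf : g ∈ T.W n → polyAct g f = f) (b : H n T) :
    diffDer φ (divDiff (polyAct g) a) (b * hw n T g) f = 0 := by
  rw [diffDer_apply]
  by_cases hg : g ∈ T.W n
  · rw [divDiff_eq_zero (hf hg), map_zero, zero_mul]
  · rw [hw_of_notMem hg, mul_zero, mul_zero]

theorem polyY_mem_evenCenter {f : MvPolynomial (Fin n) ℂ} (hf : f ∈ invariants (T.W n)) :
    polyY n T f ∈ evenCenter n T := by
  rw [mem_invariants] at hf
  refine ⟨polyY_mem_evenPart f, mem_center_of_gen (fun i => ?_) (fun i => ?_) (hc_polyY · f)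
    fun g hg => ?_⟩
  · rw [← sub_eq_zero, ← commDer_apply, commDer_polyY]
    have h0 := diffDer_eq_zero (φ := polyY n T) (a := X i + X i) (hf (tau i)) 1
    rw [one_mul, ← diffTau] at h0
    simp only [LinearMap.add_apply, LinearMap.smul_apply, LinearMap.sum_apply, h0, smul_zero,
      add_zero]
    rw [Finset.sum_eq_zero fun k _ => ?_, smul_zero]
    rw [pos, neg, diffPos, diffNeg, diffDer_eq_zero (hf _), diffDer_eq_zero (hf _), add_zero]
  · rw [← polyY_X, ← map_mul, ← map_mul, mul_comm]
  · rw [hw_polyY, hf g hg]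

/-- The homomorphism from polynomials sending the variables to the `x_i ^ 2`. -/
def polyXSq (n : ℕ) (T : Datum) : MvPolynomial (Fin n) ℂ →ₐ[ℂ] H n T :=
  (polyX n T).comp (expand 2)

theorem polyXSq_X (i : Fin n) : polyXSq n T (X i) = hx n T i * hx n T i := by
  rw [polyXSq, AlgHom.comp_apply, expand_X, map_pow, polyX_X, sq]

theorem hw_polyXSq (g : SignedPerm n) (i : Fin n) :
    hw n T g * polyXSq n T (X i) = polyXSq n T (X (g.right i)) * hw n T g := by
  rw [polyXSq_X, polyXSq_X, ← mul_assoc, hw_x, smul_mul_assoc, mul_assoc, hw_x, mul_smul_comm,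
    smul_smul, coeff_sq, one_smul, mul_assoc]

theorem hc_polyXSq (i j : Fin n) :
    hc n T i * polyXSq n T (X j) = polyXSq n T (X j) * hc n T i := by
  have h := (positionData n T).x_c j i
  rw [polyXSq_X, mul_assoc (hx n T j), h, mul_smul_comm, ← mul_assoc (hx n T j), h, smul_mul_assoc,
    smul_smul, mul_assoc, sgn]
  split_ifs <;> simp

theorem hc_hc_polyXSq (i k j : Fin n) :
    hc n T i * hc n T k * polyXSq n T (X j) = polyXSq n T (X j) * (hc n T i * hc n T k) := by
  rw [mul_assoc, hc_polyXSq, ← mul_assoc, hc_polyXSq, mul_assoc]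

theorem pos_polyXSq (k i j : Fin n) :
    pos (hc n T) (hw n T) k i * polyXSq n T (X j) =
      polyXSq n T (X (Equiv.swap k i j)) * pos (hc n T) (hw n T) k i := by
  rw [pos, mul_assoc, hw_polyXSq, ← mul_assoc, ← mul_assoc, add_mul, mul_add, hc_hc_polyXSq,
    one_mul, mul_one, swp_right]

theorem neg_polyXSq (k i j : Fin n) :
    neg (hc n T) (hw n T) k i * polyXSq n T (X j) =
      polyXSq n T (X (Equiv.swap k i j)) * neg (hc n T) (hw n T) k i := by
  rw [neg, mul_assoc, hw_polyXSq, ← mul_assoc, ← mul_assoc, sub_mul, mul_sub, hc_hc_polyXSq,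
    one_mul, mul_one, swpBar_right]

/-- Signs disappear on squares, and the Clifford factors commute with squares. So `pos` and `neg`
implement the same transposition of the `x_l²`. -/
theorem cross_polyXSq {j k : Fin n} (hjk : j ≠ k) (l : Fin n) :
    cross T.u T.v (hc n T) (hw n T) j k * polyXSq n T (X l) =
      polyXSq n T (X (Equiv.swap k j l)) * cross T.u T.v (hc n T) (hw n T) j k := by
  rw [cross, if_neg hjk, smul_mul_assoc, mul_smul_comm, sub_mul, mul_sub, pos_polyXSq,
    neg_polyXSq, Equiv.swap_comm]

theorem anti_polyXSq {j k : Fin n} (hjk : j ≠ k) (l : Fin n) :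
    anti T.u T.v (hc n T) (hw n T) (hx n T) j k * polyXSq n T (X l) =
      polyXSq n T (X (Equiv.swap k j l)) * anti T.u T.v (hc n T) (hw n T) (hx n T) j k := by
  have h : ∀ l, hx n T k * polyXSq n T (X l) = polyXSq n T (X l) * hx n T k := fun l => by
    rw [polyXSq, AlgHom.comp_apply, ← polyX_X, ← map_mul, ← map_mul, mul_comm]
  rw [anti, add_mul, mul_add, mul_assoc, h, ← mul_assoc, cross_polyXSq hjk, mul_assoc, mul_assoc,
    cross_polyXSq hjk, ← mul_assoc (hx n T k), h, mul_assoc]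

/-- The commutator of `y_j` with polynomials in the `x_i ^ 2`. -/
theorem commDer_polyXSq (j : Fin n) :
    commDer (polyXSq n T) (hy n T j) = (-1 : ℂ) • ∑ k ∈ Finset.univ.erase j,
      diffDer (polyXSq n T) (diffPos j k) (anti T.u T.v (hc n T) (hw n T) (hx n T) j k) := by
  refine (isDer_commDer _).ext (IsDer.smul _ (IsDer.sum _ fun k hk => isDer_diffDer fun l => ?_))
    fun l => ?_
  · rw [polyAct_X, coeff_swp, one_smul, swp_right,
      anti_polyXSq (Finset.ne_of_mem_erase hk).symm]
  · rw [commDer_apply, polyXSq_X, commutator_sq, hy_hx, ← anti, LinearMap.smul_apply,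
      LinearMap.sum_apply, Finset.sum_congr rfl fun k hk => by
        rw [diffDer_apply, diffPos_X (Finset.ne_of_mem_erase hk), ← MvPolynomial.algebraMap_eq,
          AlgHom.commutes, ← Algebra.smul_def]]
    split_ifs with h
    · subst h
      simp only [one_smul]
      -- At `l = j` every divided difference equals one, so the values agree by `anti_self`. At
      -- other `l` only the summand `k = l` survives.
      exact PositionData.anti_self (cliffordData n T) (positionData n T) _ _ l
    · rw [Finset.sum_eq_single l]
      · rw [if_pos rfl, smul_smul, neg_one_mul, neg_neg, one_smul]
      · intro k _ hk
        rw [if_neg hk.symm, zero_smul]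
      · intro hl
        exact (hl (Finset.mem_erase.2 ⟨h, Finset.mem_univ l⟩)).elim

theorem polyAct_expand (g : SignedPerm n) (f : MvPolynomial (Fin n) ℂ) :
    polyAct g (expand 2 f) = expand 2 (rename g.right f) := by
  induction f using MvPolynomial.induction_on with
  | C r => simp [polyAct]
  | add p q hp hq => simp only [map_add, hp, hq]
  | mul_X p i hp =>
    rw [map_mul, map_mul, hp, expand_X, map_pow, polyAct_X, smul_pow, sq, coeff_sq, one_smul,
      map_mul, map_mul, rename_X, expand_X]

theorem polyAct_swp (i j : Fin n) (f : MvPolynomial (Fin n) ℂ) :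
    polyAct (swp i j) f = rename (Equiv.swap i j) f := by
  simp only [polyAct, coeff_swp, one_smul, swp_right, rename_eq_aeval]
  rfl

theorem exists_expand_eq {f : MvPolynomial (Fin n) ℂ} (hf : f ∈ squarePolys n) :
    ∃ g, expand 2 g = f := by
  rw [squarePolys, Algebra.adjoin_range_eq_range_aeval] at hf
  obtain ⟨g, rfl⟩ := hf
  exact ⟨g, rfl⟩

theorem polyX_mem_evenCenter {f : MvPolynomial (Fin n) ℂ}
    (hf : f ∈ squarePolys n ⊓ invariants (T.W n)) : polyX n T f ∈ evenCenter n T := by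
  obtain ⟨hs, hi⟩ := hf
  obtain ⟨f, rfl⟩ := exists_expand_eq hs
  have hi := (mem_invariants _ _).1 hi
  refine ⟨polyX_mem_evenPart _, mem_center_of_gen (fun i => ?_) (fun i => ?_) (fun i => ?_)
    fun g hg => ?_⟩
  · rw [← polyX_X, ← map_mul, ← map_mul, mul_comm]
  · have h := LinearMap.congr_fun (commDer_polyXSq (T := T) i) f
    rw [commDer_apply, LinearMap.smul_apply, LinearMap.sum_apply, Finset.sum_eq_zero, smul_zero,
      sub_eq_zero] at h
    · exact h
    · intro k _
      have hk := hi (swp k i) (swp_mem_W k i)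
      -- Transpositions lie in `W` in every type. Invariance of the polynomial in the squares gives
      -- symmetry of `f` itself, because `expand 2` is injective.
      rw [polyAct_expand, swp_right, expand_inj two_pos, ← polyAct_swp] at hk
      rw [diffDer_apply, diffPos, divDiff_eq_zero hk, map_zero, zero_mul]
  · rw [hc_polyX, flip, polyAct_expand, tau_right]
    simp
  · rw [hw_polyX, hi g hg]

end Center

/-! ### Finiteness of the polynomials over the invariants -/

section Finite

variable {n : ℕ}

/-- The invariant polynomials, under all signed permutations, in the squares of the variables. -/
abbrev invSq (n : ℕ) : Subalgebra ℂ (MvPolynomial (Fin n) ℂ) := squarePolys n ⊓ invariants ⊤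

theorem invariants_anti {W W' : Subgroup (SignedPerm n)} (h : W ≤ W') :
    invariants W' ≤ invariants W := fun f hf =>
  (mem_invariants W f).2 fun g hg => (mem_invariants W' f).1 hf g (h hg)

/-- The polynomial `∏ (t² - X_j²)`. -/
def sqPoly (n : ℕ) : Polynomial (MvPolynomial (Fin n) ℂ) :=
  ∏ j, (Polynomial.X ^ 2 - Polynomial.C (X j ^ 2))

theorem sqPoly_monic : (sqPoly n).Monic :=
  Polynomial.monic_prod_of_monic _ _ fun _ _ => Polynomial.monic_X_pow_sub_C _ two_ne_zero

theorem sqPoly_coeff_mem (k : ℕ) : (sqPoly n).coeff k ∈ invSq n := by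
  refine ⟨?_, (mem_invariants _ _).2 fun g _ => ?_⟩
  · have h : sqPoly n ∈ Polynomial.lifts (algebraMap (squarePolys n) (MvPolynomial (Fin n) ℂ)) := by
      refine Subsemiring.prod_mem _ fun j _ => ?_
      rw [Polynomial.mem_lifts]
      refine ⟨Polynomial.X ^ 2 -
        Polynomial.C ⟨X j ^ 2, Algebra.subset_adjoin ⟨j, rfl⟩⟩, ?_⟩
      simp
    obtain ⟨a, ha⟩ := (Polynomial.lifts_iff_coeff_lifts _).1 h k
    rw [← ha]
    exact a.2
  · have h : (sqPoly n).map (polyAct g : MvPolynomial (Fin n) ℂ →+* MvPolynomial (Fin n) ℂ) =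
        sqPoly n := by
      simp only [sqPoly, Polynomial.map_prod]
      rw [← Equiv.prod_comp g.right
        fun j => (Polynomial.X ^ 2 - Polynomial.C (X j ^ 2 : MvPolynomial (Fin n) ℂ))]
      refine Finset.prod_congr rfl fun j _ => ?_
      rw [Polynomial.map_sub, Polynomial.map_pow, Polynomial.map_X, Polynomial.map_C]
      congr 2
      change polyAct g (X j ^ 2) = _
      rw [map_pow, polyAct_X, smul_pow, sq (coeff g j), coeff_sq, one_smul]
    conv_rhs => rw [← h, Polynomial.coeff_map]
    rfl

/-- Each variable is a root of the monic polynomial `sqPoly`, whose coefficients lie in `invSq n`.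
Integrality together with finite generation as an algebra gives finiteness as a module. -/
instance : Module.Finite (invSq n) (MvPolynomial (Fin n) ℂ) := by
  have hX : ∀ i : Fin n, IsIntegral (invSq n) (X i : MvPolynomial (Fin n) ℂ) := by
    intro i
    have h : sqPoly n ∈ Polynomial.lifts (algebraMap (invSq n) (MvPolynomial (Fin n) ℂ)) :=
      (Polynomial.lifts_iff_coeff_lifts _).2 fun k => ⟨⟨_, sqPoly_coeff_mem k⟩, rfl⟩
    obtain ⟨q, hq, -, hm⟩ := Polynomial.lifts_and_natDegree_eq_and_monic h sqPoly_monic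
    refine ⟨q, hm, ?_⟩
    rw [← Polynomial.eval_map, hq, sqPoly, Polynomial.eval_prod]
    exact Finset.prod_eq_zero (Finset.mem_univ i) (by simp)
  have hI : Algebra.IsIntegral (invSq n) (MvPolynomial (Fin n) ℂ) := by
    refine ⟨fun f => ?_⟩
    induction f using MvPolynomial.induction_on with
    | C r =>
      exact isIntegral_algebraMap (x := (⟨C r, Subalgebra.algebraMap_mem _ r⟩ : invSq n))
    | add p q hp hq => exact hp.add hq
    | mul_X p i hp => exact hp.mul (hX i)
  have hF : Algebra.FiniteType (invSq n) (MvPolynomial (Fin n) ℂ) :=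
    .of_restrictScalars_finiteType ℂ _ _
  exact Algebra.IsIntegral.finite

end Finite

/-! ### Spanning sets of the algebra -/

section Spanning

variable {n : ℕ} {T : Datum}

/-- The Clifford subalgebra. -/
def clSub (n : ℕ) (T : Datum) : Subalgebra ℂ (H n T) := Algebra.adjoin ℂ (Set.range (hc n T))

/-- The span of the ordered products of Clifford generators along a list. -/
def clWords (n : ℕ) (T : Datum) : List (Fin n) → Submodule ℂ (H n T)
  | [] => 1
  | i :: l => Submodule.span ℂ {1, hc n T i} * clWords n T l

theorem clWords_fg (l : List (Fin n)) : (clWords n T l).FG := by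
  induction l with
  | nil =>
    rw [clWords, Submodule.one_eq_span]
    exact Submodule.fg_span_singleton _
  | cons i l ih => exact Submodule.FG.mul (Submodule.fg_span (Set.toFinite _)) ih

theorem one_mem_clWords (l : List (Fin n)) : 1 ∈ clWords n T l := by
  induction l with
  | nil => exact Submodule.one_le.1 le_rfl
  | cons i l ih =>
    rw [← mul_one (1 : H n T)]
    exact Submodule.mul_mem_mul (Submodule.subset_span (Set.mem_insert _ _)) ih

/-- The generator is moved to the right, with a sign at each letter, until it reaches its own slot,
where `c_j² = 1` absorbs it. -/
theorem hc_mul_mem_clWords {j : Fin n} {l : List (Fin n)} (hj : j ∈ l) {m : H n T}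
    (hm : m ∈ clWords n T l) : hc n T j * m ∈ clWords n T l := by
  have hC := cliffordData n T
  induction l generalizing m with
  | nil => simp at hj
  | cons i l ih =>
    induction hm using Submodule.mul_induction_on' with
    | add a ha b hb ha' hb' => rw [mul_add]; exact add_mem ha' hb'
    | mem_mul_mem a ha b hb =>
      rw [← mul_assoc]
      rcases eq_or_ne j i with rfl | hji
      · refine Submodule.mul_mem_mul ?_ hb
        induction ha using Submodule.span_induction with
        | mem a ha =>
          rcases ha with rfl | rfl
          · rw [mul_one]; exact Submodule.subset_span (by simp)
          · rw [hC.c_sq]; exact Submodule.subset_span (by simp)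
        | zero => rw [mul_zero]; exact zero_mem _
        | add a b _ _ ha hb => rw [mul_add]; exact add_mem ha hb
        | smul r a _ ha => rw [mul_smul_comm]; exact Submodule.smul_mem _ _ ha
      · have hb' := ih ((List.mem_cons.1 hj).resolve_left hji) hb
        induction ha using Submodule.span_induction with
        | mem a ha =>
          rcases ha with rfl | rfl
          · rw [mul_one, ← one_mul (hc n T j * b)]
            exact Submodule.mul_mem_mul (Submodule.subset_span (by simp)) hb'
          · have e : hc n T j * hc n T i = (-1 : ℂ) • (hc n T i * hc n T j) :=
              (hC.c_anti j i hji).trans (neg_one_smul ℂ _).symm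
            rw [e, smul_mul_assoc, mul_assoc]
            exact Submodule.smul_mem _ _
              (Submodule.mul_mem_mul (Submodule.subset_span (by simp)) hb')
        | zero => rw [mul_zero, zero_mul]; exact zero_mem _
        | add a b _ _ ha hb => rw [mul_add, add_mul]; exact add_mem ha hb
        | smul r a _ ha =>
          rw [mul_smul_comm, smul_mul_assoc]; exact Submodule.smul_mem _ _ ha

/-- The elements that map a subspace to itself under left multiplication. -/
def leftStable {A : Type*} [Ring A] [Algebra ℂ A] (K : Submodule ℂ A) : Subalgebra ℂ A where
  carrier := {a | ∀ k ∈ K, a * k ∈ K}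
  mul_mem' ha hb k hk := by rw [mul_assoc]; exact ha _ (hb k hk)
  add_mem' ha hb k hk := by rw [add_mul]; exact add_mem (ha k hk) (hb k hk)
  algebraMap_mem' r k hk := by rw [← Algebra.smul_def]; exact K.smul_mem r hk

theorem clSub_le : Subalgebra.toSubmodule (clSub n T) ≤ clWords n T (List.finRange n) := by
  have h : clSub n T ≤ leftStable (clWords n T (List.finRange n)) := by
    refine Algebra.adjoin_le ?_
    rintro _ ⟨i, rfl⟩ k hk
    exact hc_mul_mem_clWords (List.mem_finRange i) hk
  intro a ha
  simpa using h ha 1 (one_mem_clWords _)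

theorem clSub_fg : (Subalgebra.toSubmodule (clSub n T)).FG := by
  have : FiniteDimensional ℂ (clWords n T (List.finRange n)) :=
    Module.Finite.iff_fg.2 (clWords_fg _)
  have := Submodule.finiteDimensional_of_le (clSub_le (n := n) (T := T))
  exact Module.Finite.iff_fg.1 this

theorem hw_clSub (g : SignedPerm n) {a : H n T} (ha : a ∈ clSub n T) :
    ∃ b ∈ clSub n T, hw n T g * a = b * hw n T g := by
  induction ha using Algebra.adjoin_induction with
  | mem a ha =>
    obtain ⟨i, rfl⟩ := ha
    refine ⟨coeff g i • hc n T (g.right i), Subalgebra.smul_mem _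
      (Algebra.subset_adjoin (Set.mem_range_self _)) _, ?_⟩
    rw [hw_c, smul_mul_assoc]
  | algebraMap r => exact ⟨_, Subalgebra.algebraMap_mem _ r, (Algebra.commutes r _).symm⟩
  | add a b _ _ ha hb =>
    obtain ⟨a', ha', ea⟩ := ha
    obtain ⟨b', hb', eb⟩ := hb
    exact ⟨a' + b', add_mem ha' hb', by rw [mul_add, ea, eb, add_mul]⟩
  | mul a b _ _ ha hb =>
    obtain ⟨a', ha', ea⟩ := ha
    obtain ⟨b', hb', eb⟩ := hb
    exact ⟨a' * b', mul_mem ha' hb', by rw [← mul_assoc, ea, mul_assoc, eb, mul_assoc]⟩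

/-- Products in the order of the Poincaré-Birkhoff-Witt decomposition. -/
def ordered (f g : MvPolynomial (Fin n) ℂ) (a : H n T) (w : SignedPerm n) : H n T :=
  polyY n T f * (polyX n T g * (a * hw n T w))

/-- The span of the ordered products. -/
def orderedSpan (n : ℕ) (T : Datum) : Submodule ℂ (H n T) :=
  Submodule.span ℂ {h | ∃ f g, ∃ a ∈ clSub n T, ∃ w, h = ordered f g a w}

theorem ordered_mem {a : H n T} (ha : a ∈ clSub n T) (f g : MvPolynomial (Fin n) ℂ)
    (w : SignedPerm n) : ordered f g a w ∈ orderedSpan n T :=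
  Submodule.subset_span ⟨f, g, a, ha, w, rfl⟩

theorem mem_leftStable_of_ordered {b : H n T}
    (h : ∀ f g, ∀ a ∈ clSub n T, ∀ w, b * ordered f g a w ∈ orderedSpan n T) :
    b ∈ leftStable (orderedSpan n T) := by
  intro k hk
  induction hk using Submodule.span_induction with
  | mem k hk =>
    obtain ⟨f, g, a, ha, w, rfl⟩ := hk
    exact h f g a ha w
  | zero => rw [mul_zero]; exact zero_mem _
  | add a b _ _ ha hb => rw [mul_add]; exact add_mem ha hb
  | smul r a _ ha => rw [mul_smul_comm]; exact Submodule.smul_mem _ _ ha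

theorem hy_mem_leftStable (i : Fin n) : hy n T i ∈ leftStable (orderedSpan n T) :=
  mem_leftStable_of_ordered fun f g a ha w => by
    rw [ordered, ← mul_assoc, ← polyY_X, ← map_mul]
    exact ordered_mem ha _ _ _

theorem hc_mem_leftStable (i : Fin n) : hc n T i ∈ leftStable (orderedSpan n T) :=
  mem_leftStable_of_ordered fun f g a ha w => by
    rw [ordered, ← mul_assoc, hc_polyY, mul_assoc, ← mul_assoc (hc n T i), hc_polyX, mul_assoc,
      ← mul_assoc (hc n T i)]
    exact ordered_mem (mul_mem (Algebra.subset_adjoin ⟨i, rfl⟩) ha) _ _ _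

theorem hw_mem_leftStable (v : SignedPerm n) : hw n T v ∈ leftStable (orderedSpan n T) := by
  by_cases hv : v ∈ T.W n
  · refine mem_leftStable_of_ordered fun f g a ha w => ?_
    obtain ⟨b, hb, e⟩ := hw_clSub v ha
    rw [ordered, ← mul_assoc, hw_polyY, mul_assoc, ← mul_assoc (hw n T v), hw_polyX, mul_assoc,
      ← mul_assoc (hw n T v), e, mul_assoc, (cliffordData n T).mul_left v hv]
    exact ordered_mem hb _ _ _
  · rw [hw_of_notMem hv]
    exact zero_mem _

theorem cross_mem_leftStable (j i : Fin n) :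
    cross T.u T.v (hc n T) (hw n T) j i ∈ leftStable (orderedSpan n T) := by
  have hp : ∀ k i, pos (hc n T) (hw n T) k i ∈ leftStable (orderedSpan n T) := fun k i =>
    mul_mem (add_mem (one_mem _) (mul_mem (hc_mem_leftStable k) (hc_mem_leftStable i)))
      (hw_mem_leftStable _)
  have hn : ∀ k i, neg (hc n T) (hw n T) k i ∈ leftStable (orderedSpan n T) := fun k i =>
    mul_mem (sub_mem (one_mem _) (mul_mem (hc_mem_leftStable k) (hc_mem_leftStable i)))
      (hw_mem_leftStable _)
  rw [cross]
  split_ifs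
  · exact sub_mem (neg_mem (Subalgebra.smul_mem _ (sum_mem fun k _ => add_mem (hp k i) (hn k i)) _))
      (Subalgebra.smul_mem _ (hw_mem_leftStable _) _)
  · exact Subalgebra.smul_mem _ (sub_mem (hp j i) (hn j i)) _

/-- Induction on the polynomial in `y`. Moving `x_i` past `y_l` costs a `cross`, which is built from
the `c_k` and group elements only and is already known to preserve the span. -/
theorem hx_mem_leftStable (i : Fin n) : hx n T i ∈ leftStable (orderedSpan n T) :=
  mem_leftStable_of_ordered fun f g a ha w => by
    induction f using MvPolynomial.induction_on with
    | C r =>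
      have e : ordered (C r) g a w = r • (polyX n T g * (a * hw n T w)) := by
        rw [ordered, ← MvPolynomial.algebraMap_eq, AlgHom.commutes, Algebra.smul_def]
      rw [e, mul_smul_comm, ← mul_assoc, ← polyX_X, ← map_mul]
      refine Submodule.smul_mem _ _ ?_
      have := ordered_mem ha 1 (X i * g) w
      rwa [ordered, map_one, one_mul] at this
    | add p q hp hq =>
      rw [ordered, map_add, add_mul, mul_add]
      exact add_mem hp hq
    | mul_X p l hp =>
      have e : ordered (p * X l) g a w = hy n T l * ordered p g a w := by
        rw [ordered, ordered, mul_comm, map_mul, polyY_X, mul_assoc]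
      have e' : hx n T i * hy n T l =
          hy n T l * hx n T i - cross T.u T.v (hc n T) (hw n T) l i := by
        rw [← hy_hx, sub_sub_cancel]
      rw [e, ← mul_assoc, e', sub_mul, mul_assoc]
      exact sub_mem (hy_mem_leftStable l _ hp) (cross_mem_leftStable l i _ (ordered_mem ha _ _ _))

/-- The span is stable under left multiplication by all generators, so it is a left ideal, and it
contains `1`. -/
theorem orderedSpan_eq_top : orderedSpan n T = ⊤ := by
  have h : leftStable (orderedSpan n T) = ⊤ := eq_top_of_gen_mem hx_mem_leftStable
    hy_mem_leftStable hc_mem_leftStable fun g _ => hw_mem_leftStable g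
  rw [eq_top_iff]
  intro a _
  have ha : a ∈ leftStable (orderedSpan n T) := h ▸ Algebra.mem_top
  have h1 : (1 : H n T) ∈ orderedSpan n T := by
    simpa [ordered, hw_one] using ordered_mem (T := T) (one_mem (clSub n T)) 1 1 1
  simpa using ha 1 h1

theorem mul_mem_of_evenCenter (N : Submodule (evenCenter n T) (H n T)) {z a : H n T}
    (hz : z ∈ evenCenter n T) (ha : a ∈ N) : z * a ∈ N :=
  N.smul_mem ⟨z, hz⟩ ha

theorem smul_mem_of_complex (N : Submodule (evenCenter n T) (H n T)) (r : ℂ) {a : H n T}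
    (ha : a ∈ N) : r • a ∈ N := by
  rw [Algebra.smul_def]
  exact mul_mem_of_evenCenter N (Subalgebra.algebraMap_mem _ r) ha

theorem polyY_invSq_mem {r : MvPolynomial (Fin n) ℂ} (hr : r ∈ invSq n) :
    polyY n T r ∈ evenCenter n T :=
  polyY_mem_evenCenter (invariants_anti le_top hr.2)

theorem polyX_invSq_mem {r : MvPolynomial (Fin n) ℂ} (hr : r ∈ invSq n) :
    polyX n T r ∈ evenCenter n T :=
  polyX_mem_evenCenter ⟨hr.1, invariants_anti le_top hr.2⟩

theorem evenCenter_comm {z : H n T} (hz : z ∈ evenCenter n T) (a : H n T) : a * z = z * a :=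
  Subalgebra.mem_center_iff.1 hz.2 a

instance : Finite (SignedPerm n) := Finite.of_equiv _ SemidirectProduct.equivProd.symm

/-- Each of the four factors of an ordered product is reduced to a finite set: the two polynomials
modulo `invSq n`, the Clifford part by finite dimensionality, the group part by finiteness. -/
theorem finite_over_evenCenter : Module.Finite (evenCenter n T) (H n T) := by
  obtain ⟨P, hP⟩ := Module.Finite.fg_top (R := invSq n) (M := MvPolynomial (Fin n) ℂ)
  obtain ⟨B, hB⟩ := clSub_fg (n := n) (T := T)
  let t : Set (H n T) := (fun p : (MvPolynomial (Fin n) ℂ × MvPolynomial (Fin n) ℂ) ×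
    H n T × SignedPerm n => ordered p.1.1 p.1.2 p.2.1 p.2.2) ''
      (((P : Set _) ×ˢ (P : Set _)) ×ˢ ((B : Set _) ×ˢ Set.univ))
  have ht : t.Finite := ((P.finite_toSet.prod P.finite_toSet).prod
    (B.finite_toSet.prod Set.finite_univ)).image _
  refine ⟨Submodule.fg_def.2 ⟨t, ht, ?_⟩⟩
  set N := Submodule.span (evenCenter n T) t
  have h1 : ∀ f ∈ P, ∀ g ∈ P, ∀ a ∈ clSub n T, ∀ w, ordered f g a w ∈ N := by
    intro f hf g hg a ha w
    replace ha : a ∈ Submodule.span ℂ (B : Set (H n T)) := by rw [hB]; exact ha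
    induction ha using Submodule.span_induction with
    | mem a ha => exact Submodule.subset_span ⟨((f, g), (a, w)), ⟨⟨hf, hg⟩, ⟨ha, trivial⟩⟩, rfl⟩
    | zero => simp [ordered]
    | add a b _ _ ha hb =>
      have e : ordered f g (a + b) w = ordered f g a w + ordered f g b w := by
        simp only [ordered, add_mul, mul_add]
      rw [e]; exact add_mem ha hb
    | smul r a _ ha =>
      have e : ordered f g (r • a) w = r • ordered f g a w := by
        simp only [ordered, smul_mul_assoc, mul_smul_comm]
      rw [e]; exact smul_mem_of_complex N r ha
  have h2 : ∀ f ∈ P, ∀ g, ∀ a ∈ clSub n T, ∀ w, ordered f g a w ∈ N := by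
    intro f hf g a ha w
    have hg : g ∈ Submodule.span (invSq n) (P : Set (MvPolynomial (Fin n) ℂ)) := by
      rw [hP]; trivial
    induction hg using Submodule.span_induction with
    | mem g hg => exact h1 f hf g hg a ha w
    | zero => simp [ordered]
    | add p q _ _ hp hq =>
      have e : ordered f (p + q) a w = ordered f p a w + ordered f q a w := by
        simp only [ordered, map_add, add_mul, mul_add]
      rw [e]; exact add_mem hp hq
    | smul r p _ hp =>
      have hr := polyX_invSq_mem (T := T) r.2
      have e : ordered f (r • p) a w = polyX n T r * ordered f p a w := by
        rw [Algebra.smul_def, ordered, ordered, map_mul, mul_assoc, ← mul_assoc (polyY n T f),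
          ← mul_assoc (polyX n T r.1)]
        congr 1
        -- The scalar arises to the right of the `y`-polynomial; being central, it can be moved to
        -- the front.
        exact evenCenter_comm hr _
      rw [e]; exact mul_mem_of_evenCenter N hr hp
  have h3 : ∀ f g, ∀ a ∈ clSub n T, ∀ w, ordered f g a w ∈ N := by
    intro f g a ha w
    have hf : f ∈ Submodule.span (invSq n) (P : Set (MvPolynomial (Fin n) ℂ)) := by
      rw [hP]; trivial
    induction hf using Submodule.span_induction with
    | mem f hf => exact h2 f hf g a ha w
    | zero => simp [ordered]
    | add p q _ _ hp hq =>
      have e : ordered (p + q) g a w = ordered p g a w + ordered q g a w := by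
        simp only [ordered, map_add, add_mul]
      rw [e]; exact add_mem hp hq
    | smul r p _ hp =>
      have e : ordered (r • p) g a w = polyY n T r * ordered p g a w := by
        rw [Algebra.smul_def, ordered, ordered, map_mul, mul_assoc]
        rfl
      rw [e]; exact mul_mem_of_evenCenter N (polyY_invSq_mem r.2) hp
  rw [eq_top_iff]
  intro b _
  have hb : b ∈ orderedSpan n T := orderedSpan_eq_top ▸ Submodule.mem_top
  induction hb using Submodule.span_induction with
  | mem b hb =>
    obtain ⟨f, g, a, ha, w, rfl⟩ := hb
    exact h3 f g a ha w
  | zero => exact zero_mem _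
  | add a b _ _ ha hb => exact add_mem (ha trivial) (hb trivial)
  | smul r a _ ha => exact smul_mem_of_complex N r (ha trivial)

end Spanning

end Dahca

end

theorem proposition4 (n : ℕ) (T : Dahca.Datum) :
    ((Dahca.invariants (T.W n)).map (Dahca.polyY n T) ≤ Dahca.evenCenter n T ∧
      Set.InjOn (Dahca.polyY n T)
        (Dahca.invariants (T.W n) : Set (MvPolynomial (Fin n) ℂ))) ∧
    ((Dahca.squarePolys n ⊓ Dahca.invariants (T.W n)).map (Dahca.polyX n T) ≤
        Dahca.evenCenter n T ∧
      Set.InjOn (Dahca.polyX n T)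
        ((Dahca.squarePolys n ⊓ Dahca.invariants (T.W n) :
          Subalgebra ℂ (MvPolynomial (Fin n) ℂ)) : Set (MvPolynomial (Fin n) ℂ))) ∧
    Module.Finite (Dahca.evenCenter n T) (Dahca.H n T) := by
  refine ⟨⟨?_, (Dahca.polyY_injective n T).injOn⟩, ⟨?_, (Dahca.polyX_injective n T).injOn⟩,
    Dahca.finite_over_evenCenter⟩
  · rintro _ ⟨f, hf, rfl⟩
    exact Dahca.polyY_mem_evenCenter hf
  · rintro _ ⟨f, hf, rfl⟩
    exact Dahca.polyX_mem_evenCenter hf
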